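/- Virtual links are taken as equivalence classes of Gauss diagrams (oriented circles with directed chords carrying a sign $\pm1$; a chord points from over- to under-crossing) modulo the Reidemeister moves; a virtual knot diagram is recorded by its Gauss diagram, which has one circle. A virtual knot diagram $K$ is periodic with period $N$ if its Gauss diagram is invariant under the rotation of the circle by $2\pi/N$, and its quotient $K_*$ is the virtual knot diagram whose Gauss diagram is the quotient of that of $K$ by this rotation. (A planar virtual knot diagram that misses the origin and is invariant under the rotation of the plane by $2\pi/N$ about the origin has a Gauss diagram of this kind, and closing up one fundamental domain gives $K_*$.) Let $\sigma_i$, $\tau_i$ ($1\le i<k$) be the standard generators of the virtual braid group $VB_k$, where $\sigma_i$ is a positive classical crossing and $\tau_i$ a virtual crossing of the strands in positions $i,i+1$, and let $\Psi\colon VB_k\to GL_k(\mathbb Z[s^{\pm1},t^{\pm1},q^{\pm1}])$ be the virtual Burau representation $$\Psi(\sigma_i)=I_{i-1}\oplus\begin{pmatrix}1-st&t\\ s&0\end{pmatrix}\oplus I_{k-i-1},\qquad \Psi(\tau_i)=I_{i-1}\oplus\begin{pmatrix}0&q^{-1}\\ q&0\end{pmatrix}\oplus I_{k-i-1}.$$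 For a virtual knot $K$, the normalized virtual Alexander polynomial is $$\widehat H_K(s,t,q)=(-1)^{\operatorname{writhe}(\beta)+v(\beta)}\det\bigl(\Psi(\beta)-I_k\bigr)$$ for any virtual braid $\beta$ (on any number $k\ge 1$ of strands) whose closure represents the virtual knot $K$, where $\operatorname{writhe}(\beta)$ is the sum of the signs of the classical crossings and $v(\beta)$ the number of virtual crossings of $\beta$; it is defined up to multiplication by powers of $st$. **Proposition.** Let $p$ be a prime, $r\ge 0$, and let $K$ be a virtual knot diagram that is periodic with period $p^r$, with quotient $K_*$. Then $K$ and $K_*$ are each virtually isotopic to the closure of a virtual braid, so that $\widehat H_K$ and $\widehat H_{K_*}$ are defined, and, for all choices of the braids used to compute them, there is an integer $m$ with $$\widehat H_K(s,t,q)\equiv (st)^m\,\bigl[\widehat H_{K_*}(s,t,q)\bigr]^{p^r}\pmod p$$ in $\mathbb Z[s^{\pm1},t^{\pm1},q^{\pm1}]$. -/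

import Mathlib

noncomputable section

namespace VirtualKnot

/-! ### Gauss diagrams of virtual links -/

/-- A directed signed chord: it points from its over-crossing end to its under-crossing end. -/
structure Chord (E : Type) where
  overEnd : E
  underEnd : E
  sign : ℤˣ

/-- Transport of a chord along a map of the endpoints. -/
def Chord.map {E F : Type} (f : E → F) (c : Chord E) : Chord F :=
  ⟨f c.overEnd, f c.underEnd, c.sign⟩

/-- A Gauss diagram.  Its oriented base circles are subdivided by a finite set `E` of points, at
least one on each circle, and `next e` is the point that follows `e` on its circle, so the circles
are the cycles of `next`.  The chords join points of `E`, and every point of `E` is an end of at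
most one chord; the remaining points of `E` are plain subdivision points. -/
structure GaussDiagram (E : Type) where
  finite : Finite E
  next : Equiv.Perm E
  chords : Set (Chord E)
  over_ne_under : ∀ c ∈ chords, ∀ d ∈ chords, c.overEnd ≠ d.underEnd
  over_inj : ∀ c ∈ chords, ∀ d ∈ chords, c.overEnd = d.overEnd → c = d
  under_inj : ∀ c ∈ chords, ∀ d ∈ chords, c.underEnd = d.underEnd → c = d

namespace GaussDiagram

variable {E F : Type}

/-- The diagram has exactly one base circle. -/
def IsKnot (G : GaussDiagram E) : Prop :=
  Nonempty E ∧ ∀ x y : E, G.next.SameCycle x y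

/-- `G'` is `G` with its points renamed along a bijection. -/
def IsRelabeling (G : GaussDiagram E) (G' : GaussDiagram F) : Prop :=
  ∃ f : E ≃ F, (∀ e, G'.next (f e) = f (G.next e)) ∧ G'.chords = Chord.map f '' G.chords

/-- `G'` is `G` with one more subdivision point `d`, placed on one of the circles of `G`. -/
def IsSubdivision (G : GaussDiagram E) (G' : GaussDiagram F) : Prop :=
  ∃ (f : E → F) (d : F), Function.Injective f ∧ Set.range f = {d}ᶜ ∧ G'.next d ≠ d ∧
    (∀ e, G'.next (f e) = f (G.next e) ∨
      (G'.next (f e) = d ∧ G'.next d = f (G.next e))) ∧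
    G'.chords = Chord.map f '' G.chords

/-- First Reidemeister move: `G'` is `G` with a chord `x` added whose two ends are consecutive. -/
def IsReidemeister1 (G G' : GaussDiagram E) : Prop :=
  G'.next = G.next ∧ ∃ x : Chord E, x ∉ G.chords ∧ G'.chords = G.chords ∪ {x} ∧
    (G.next x.overEnd = x.underEnd ∨ G.next x.underEnd = x.overEnd)

/-- Second Reidemeister move: `G'` is `G` with two chords `x`, `y` of opposite signs added, whose
over-ends are consecutive and whose under-ends are consecutive (in either order). -/
def IsReidemeister2 (G G' : GaussDiagram E) : Prop :=
  G'.next = G.next ∧ ∃ x y : Chord E, x ≠ y ∧ x ∉ G.chords ∧ y ∉ G.chords ∧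
    G'.chords = G.chords ∪ {x, y} ∧ x.sign = -y.sign ∧
    G.next x.overEnd = y.overEnd ∧
    (G.next x.underEnd = y.underEnd ∨ G.next y.underEnd = x.underEnd)

/-- `a` and `b` are consecutive; `o = 1` if `a` comes first and `o = -1` if `b` comes first. -/
def Consecutive (G : GaussDiagram E) (o : ℤˣ) (a b : E) : Prop :=
  (o = 1 ∧ G.next a = b) ∨ (o = -1 ∧ G.next b = a)

open Classical in
/-- Third Reidemeister move, for three strands: a top one with crossings `x`, `y`, a middle one
with crossings `x`, `z` and a bottom one with crossings `y`, `z`.  The move reverses the order of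
the two crossings on each strand.  The three orders `oT`, `oM`, `oB` before the move and the signs
are those of three oriented lines in general position in the plane: the sign of the crossing of two
of the strands is the product of their orders, up to one common sign `κ`. -/
def IsReidemeister3 (G G' : GaussDiagram E) : Prop :=
  G'.next = G.next ∧ ∃ x ∈ G.chords, ∃ y ∈ G.chords, ∃ z ∈ G.chords,
    x ≠ y ∧ x ≠ z ∧ y ≠ z ∧
    ∃ oT oM oB κ : ℤˣ,
      G.Consecutive oT x.overEnd y.overEnd ∧
      G.Consecutive oM x.underEnd z.overEnd ∧
      G.Consecutive oB y.underEnd z.underEnd ∧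
      x.sign = κ * oT * oM ∧ y.sign = κ * oT * oB ∧ z.sign = κ * oM * oB ∧
      G'.chords = Chord.map (Equiv.swap x.overEnd y.overEnd * Equiv.swap x.underEnd z.overEnd *
        Equiv.swap y.underEnd z.underEnd : Equiv.Perm E) '' G.chords

end GaussDiagram

/-- Virtual isotopy: the equivalence relation on Gauss diagrams generated by the Reidemeister
moves (renaming or subdividing does not change the underlying diagram).  Its classes are the
virtual links. -/
inductive VirtuallyIsotopic : {E F : Type} → GaussDiagram E → GaussDiagram F → Prop
  | refl {E : Type} (G : GaussDiagram E) : VirtuallyIsotopic G G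
  | symm {E F : Type} {G : GaussDiagram E} {G' : GaussDiagram F} :
      VirtuallyIsotopic G G' → VirtuallyIsotopic G' G
  | trans {E F H : Type} {G : GaussDiagram E} {G' : GaussDiagram F} {G'' : GaussDiagram H} :
      VirtuallyIsotopic G G' → VirtuallyIsotopic G' G'' → VirtuallyIsotopic G G''
  | relabel {E F : Type} {G : GaussDiagram E} {G' : GaussDiagram F} :
      G.IsRelabeling G' → VirtuallyIsotopic G G'
  | subdivide {E F : Type} {G : GaussDiagram E} {G' : GaussDiagram F} :
      G.IsSubdivision G' → VirtuallyIsotopic G G'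
  | reidemeister1 {E : Type} {G G' : GaussDiagram E} :
      G.IsReidemeister1 G' → VirtuallyIsotopic G G'
  | reidemeister2 {E : Type} {G G' : GaussDiagram E} :
      G.IsReidemeister2 G' → VirtuallyIsotopic G G'
  | reidemeister3 {E : Type} {G G' : GaussDiagram E} :
      G.IsReidemeister3 G' → VirtuallyIsotopic G G'

/-! ### Periodic diagrams and their quotients -/

namespace GaussDiagram

variable {E : Type}

/-- The rotation by the angle `2 * π / N` of a base circle with equally spaced points: every point
moves `Nat.card E / N` steps forward. -/
def rotation (G : GaussDiagram E) (N : ℕ) : Equiv.Perm E :=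
  G.next ^ (Nat.card E / N)

/-- A Gauss diagram of a virtual knot is periodic with period `N` if it is invariant under the
rotation of its base circle by the angle `2 * π / N`. -/
structure IsPeriodic (G : GaussDiagram E) (N : ℕ) : Prop where
  isKnot : G.IsKnot
  dvd_card : N ∣ Nat.card E
  map_mem : ∀ c ∈ G.chords, Chord.map (G.rotation N) c ∈ G.chords

theorem IsPeriodic.map_pow_mem {G : GaussDiagram E} {N : ℕ} (h : G.IsPeriodic N) (j : ℕ) :
    ∀ c ∈ G.chords, Chord.map ((G.rotation N ^ j : Equiv.Perm E)) c ∈ G.chords := by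
  induction j with
  | zero => intro c hc; simpa [Chord.map] using hc
  | succ j ih =>
    intro c hc
    have := h.map_mem _ (ih c hc)
    simpa [Chord.map, pow_succ'] using this

theorem IsPeriodic.exists_pow {G : GaussDiagram E} {N : ℕ} {x y : E}
    (hxy : (G.rotation N).SameCycle x y) : ∃ j : ℕ, (G.rotation N ^ j : Equiv.Perm E) x = y := by
  have := G.finite
  obtain ⟨i, -, hi⟩ := hxy.exists_pow_eq'
  exact ⟨i, hi⟩

/-- The base circle modulo the rotation. -/
abbrev QuotientPoint (G : GaussDiagram E) (N : ℕ) : Type :=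
  Quotient (Equiv.Perm.SameCycle.setoid (G.rotation N))

/-- The projection of the base circle to its quotient by the rotation. -/
def toQuotient (G : GaussDiagram E) (N : ℕ) (e : E) : G.QuotientPoint N :=
  Quotient.mk _ e

theorem toQuotient_eq_iff (G : GaussDiagram E) (N : ℕ) (x y : E) :
    G.toQuotient N x = G.toQuotient N y ↔ (G.rotation N).SameCycle x y :=
  Quotient.eq

theorem commute_next (G : GaussDiagram E) (N : ℕ) : Commute (G.rotation N) G.next :=
  (Commute.refl G.next).pow_left _

theorem sameCycle_next_iff (G : GaussDiagram E) (N : ℕ) (x y : E) :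
    (G.rotation N).SameCycle x y ↔ (G.rotation N).SameCycle (G.next x) (G.next y) := by
  refine exists_congr fun i => ?_
  have h : (G.rotation N ^ i * G.next) x = (G.next * G.rotation N ^ i) x := by
    rw [((G.commute_next N).zpow_left i).eq]
  rw [Equiv.Perm.mul_apply, Equiv.Perm.mul_apply] at h
  rw [h, G.next.injective.eq_iff]

/-- The quotient of a periodic Gauss diagram by its rotation: one fundamental domain, closed up. -/
def quotient (G : GaussDiagram E) (N : ℕ) (h : G.IsPeriodic N) :
    GaussDiagram (G.QuotientPoint N) where
  finite := by
    have := G.finite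
    infer_instance
  next := Quotient.congr G.next (G.sameCycle_next_iff N)
  chords := Chord.map (G.toQuotient N) '' G.chords
  over_ne_under := by
    rintro _ ⟨c, hc, rfl⟩ _ ⟨d, hd, rfl⟩ hcd
    obtain ⟨j, hj⟩ := IsPeriodic.exists_pow ((G.toQuotient_eq_iff N _ _).1 hcd)
    exact G.over_ne_under _ (h.map_pow_mem j c hc) d hd hj
  over_inj := by
    rintro _ ⟨c, hc, rfl⟩ _ ⟨d, hd, rfl⟩ hcd
    obtain ⟨j, hj⟩ := IsPeriodic.exists_pow ((G.toQuotient_eq_iff N _ _).1 hcd)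
    have he := G.over_inj _ (h.map_pow_mem j c hc) d hd hj
    rw [← he]
    simp only [Chord.map, Chord.mk.injEq, toQuotient_eq_iff, and_true]
    exact ⟨⟨j, by simp⟩, ⟨j, by simp⟩⟩
  under_inj := by
    rintro _ ⟨c, hc, rfl⟩ _ ⟨d, hd, rfl⟩ hcd
    obtain ⟨j, hj⟩ := IsPeriodic.exists_pow ((G.toQuotient_eq_iff N _ _).1 hcd)
    have he := G.under_inj _ (h.map_pow_mem j c hc) d hd hj
    rw [← he]
    simp only [Chord.map, Chord.mk.injEq, toQuotient_eq_iff, and_true]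
    exact ⟨⟨j, by simp⟩, ⟨j, by simp⟩⟩

end GaussDiagram

/-! ### Virtual braids -/

/-- The generators of the virtual braid group on `n + 1` strands and their inverses: `sigma i ε` is
a classical crossing of sign `ε` of the strands in the positions `i`, `i + 1`, and `tau i` is a
virtual crossing of them. -/
inductive BraidLetter (n : ℕ) where
  | sigma (i : Fin n) (ε : ℤˣ)
  | tau (i : Fin n)

/-- A virtual braid on `n + 1` strands, as a word in the generators, read from top to bottom. -/
abbrev VirtualBraid (n : ℕ) : Type := List (BraidLetter n)

/-- The permutation of the positions of the strands. -/
def BraidLetter.perm {n : ℕ} : BraidLetter n → Equiv.Perm (Fin (n + 1))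
  | .sigma i _ => Equiv.swap i.castSucc i.succ
  | .tau i => Equiv.swap i.castSucc i.succ

namespace VirtualBraid

variable {n : ℕ}

/-- The permutation of the letter at level `l`, and the identity at the level below the braid. -/
def permAt (β : VirtualBraid n) (l : ℕ) : Equiv.Perm (Fin (n + 1)) :=
  match β[l]? with
  | some g => g.perm
  | none => 1

/-- The Gauss diagram of the closure of a virtual braid.  The point `(l, j)` lies on the strand
that enters the `l`-th letter in position `j`; the points of the last level lie on the strands that
close the braid.  With strands oriented downwards, a positive crossing is one where the over-strand
comes in from the right.  Virtual crossings carry no chord. -/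
def closure (β : VirtualBraid n) : GaussDiagram (Fin (β.length + 1) × Fin (n + 1)) where
  finite := inferInstance
  next := Equiv.prodShear (finRotate (β.length + 1)) fun l => β.permAt l
  chords := {c | ∃ (l : Fin (β.length + 1)) (i : Fin n),
    (β[(l : ℕ)]? = some (.sigma i 1) ∧ c = ⟨(l, i.succ), (l, i.castSucc), 1⟩) ∨
    (β[(l : ℕ)]? = some (.sigma i (-1)) ∧ c = ⟨(l, i.castSucc), (l, i.succ), -1⟩)}
  over_ne_under := by
    rintro c ⟨l, i, ⟨h, rfl⟩ | ⟨h, rfl⟩⟩ d ⟨l', i', ⟨h', rfl⟩ | ⟨h', rfl⟩⟩ he <;>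
    · simp only [Prod.mk.injEq, Fin.ext_iff, Fin.val_succ, Fin.val_castSucc] at he
      obtain ⟨hl, hi⟩ := he
      rw [hl, h'] at h
      simp at h
      try omega
  over_inj := by
    rintro c ⟨l, i, ⟨h, rfl⟩ | ⟨h, rfl⟩⟩ d ⟨l', i', ⟨h', rfl⟩ | ⟨h', rfl⟩⟩ he <;>
    · simp only [Prod.mk.injEq] at he
      obtain ⟨rfl, hi⟩ := he
      rw [h'] at h
      simp at h
      try simp [h]
  under_inj := by
    rintro c ⟨l, i, ⟨h, rfl⟩ | ⟨h, rfl⟩⟩ d ⟨l', i', ⟨h', rfl⟩ | ⟨h', rfl⟩⟩ he <;>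
    · simp only [Prod.mk.injEq] at he
      obtain ⟨rfl, hi⟩ := he
      rw [h'] at h
      simp at h
      try simp [h]

/-- The sum of the signs of the classical crossings. -/
def writhe (β : VirtualBraid n) : ℤ :=
  (β.map fun g => match g with
    | .sigma _ ε => (ε : ℤ)
    | .tau _ => 0).sum

/-- The number of virtual crossings. -/
def virtualCrossings (β : VirtualBraid n) : ℤ :=
  (β.map fun g => match g with
    | .sigma _ _ => (0 : ℤ)
    | .tau _ => 1).sum

end VirtualBraid

/-! ### The normalized virtual Alexander polynomial -/

/-- The ring of integral Laurent polynomials in the variables `s`, `t`, `q`. -/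
abbrev Laurent : Type := AddMonoidAlgebra ℤ (ℤ × ℤ × ℤ)

/-- The monomial `s ^ a * t ^ b * q ^ c`. -/
def mono (a b c : ℤ) : Laurent := AddMonoidAlgebra.single (a, b, c) 1

/-- The identity matrix with its block in the rows and columns `i`, `i + 1` replaced by
`!![a, b; c, d]`. -/
def blockAt {n : ℕ} (i : Fin n) (a b c d : Laurent) :
    Matrix (Fin (n + 1)) (Fin (n + 1)) Laurent :=
  Matrix.of fun x y =>
    if x = i.castSucc then
      if y = i.castSucc then a else if y = i.succ then b else 0
    else if x = i.succ then
      if y = i.castSucc then c else if y = i.succ then d else 0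
    else if x = y then 1 else 0

/-- The virtual Burau matrix of a generator; the matrices of `sigma i 1` and `sigma i (-1)` are
inverse to each other. -/
def BraidLetter.burau {n : ℕ} : BraidLetter n → Matrix (Fin (n + 1)) (Fin (n + 1)) Laurent
  | .sigma i ε =>
    if ε = 1 then blockAt i (1 - mono 1 1 0) (mono 0 1 0) (mono 1 0 0) 0
    else blockAt i 0 (mono (-1) 0 0) (mono 0 (-1) 0) (1 - mono (-1) (-1) 0)
  | .tau i => blockAt i 0 (mono 0 0 (-1)) (mono 0 0 1) 0

namespace VirtualBraid

variable {n : ℕ}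

/-- The virtual Burau representation. -/
def burau (β : VirtualBraid n) : Matrix (Fin (n + 1)) (Fin (n + 1)) Laurent :=
  (β.map BraidLetter.burau).prod

/-- `(-1) ^ (writhe β + v β) * det (Ψ β - I)`. -/
def normalizedDet (β : VirtualBraid n) : Laurent :=
  (((-1 : ℤˣ) ^ (β.writhe + β.virtualCrossings) : ℤˣ) : ℤ) • (β.burau - 1).det

end VirtualBraid

/-- `h` is a value of the normalized virtual Alexander polynomial of the virtual knot represented
by `K`: up to a power of `s * t`, it is computed from a virtual braid whose closure represents this
virtual knot. -/
def IsNormalizedVirtualAlexander {E : Type} (K : GaussDiagram E) (h : Laurent) : Prop :=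
  ∃ (n : ℕ) (β : VirtualBraid n) (m : ℤ),
    VirtuallyIsotopic β.closure K ∧ h = mono m m 0 * β.normalizedDet

end VirtualKnot

end

/-! Attach an unknown to each arc of a Gauss diagram and a linear equation to each point. Read
against the orientation, an over-end of a chord of sign ε multiplies the unknown by s^ε; an
under-end multiplies it by t^ε and adds (1 - (st)^ε) times the unknown leaving the over-end. The
coefficient matrix is `alexanderMatrix`; let Δ be its determinant. The theorem follows from four
facts.

Invariance: Δ depends on the virtual link only, up to powers of st
(`VirtuallyIsotopic.alexanderInvariant_eq`). Eliminating the unknowns inside the part of the diagram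
changed by a move (`det_add_local`) leaves a matrix that sees this part only through its transition
matrix, which every Reidemeister move preserves. The elimination also splits off a determinant,
which differs from 1 only for the kink whose over-end comes first, where it is (st)^ε.

Comparison with Burau: for a braid closure, Δ with s, t replaced by s/q, tq is exactly the
normalized determinant (`alexanderDet_closure`). Conjugation by powers of q turns virtual crossings
into plain permutations, and the system becomes block cyclic, one block per letter. The sign of the
successor permutation of the closure accounts for (-1)^(writhe + v).

Periodicity: the points of K are p^r copies of those of its quotient, and the matrix of K is block
circulant for the rotation. In characteristic p, a polynomial a evaluated at a matrix T with T^(p^r)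
= 1 satisfies a(T)^(p^r) = a(1)^(p^r). Hence the determinant is the p^r-th power of that of the sum
of the blocks (`det_blockCirculant`), and this sum is the matrix of the quotient
(`sum_alexanderMatrix_rotation`).

Existence: every diagram with at least one point is a braid closure up to isotopy
(`exists_closure_virtuallyIsotopic`). Each point gets its own strand, each chord one classical
crossing, and virtual crossings supply all the permutations needed. -/

noncomputable section
namespace VirtualKnot

open Matrix

/-! ### The Alexander system of a Gauss diagram -/

section Weights

variable {E F R : Type*} [DecidableEq E] [DecidableEq F] [CommRing R]

/-- The matrix with the column `j` equal to the unit vector at `ι j`. -/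
def incidence (R : Type*) [CommRing R] {I : Type*} (ι : I → E) : Matrix E I R :=
  (1 : Matrix E E R).submatrix id ι

theorem incidence_apply {I : Type*} (ι : I → E) (x : E) (i : I) :
    incidence R ι x i = if x = ι i then 1 else 0 := by
  simp [incidence, Matrix.one_apply]

theorem mul_incidence [Fintype E] {I X : Type*} (ι : I → E) (A : Matrix X E R) :
    A * incidence R ι = A.submatrix id ι := by
  ext x i
  simp [Matrix.mul_apply, incidence_apply]

theorem incidence_transpose_mul [Fintype E] {I X : Type*} (ι : I → E) (A : Matrix E X R) :
    (incidence R ι)ᵀ * A = A.submatrix ι id := by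
  ext x i
  simp [Matrix.mul_apply, incidence_apply]

theorem incidence_mul_single_mul_transpose [Fintype F] (ι : F → E) (x y : F) (r : R) :
    incidence R ι * Matrix.single x y r * (incidence R ι)ᵀ = Matrix.single (ι x) (ι y) r := by
  ext a b
  simp only [Matrix.mul_apply, Matrix.transpose_apply, incidence_apply, Matrix.single_apply]
  simp only [ite_mul, one_mul, zero_mul, mul_ite, mul_one, mul_zero]
  rw [Finset.sum_eq_single y]
  · rw [Finset.sum_eq_single x]
    · by_cases ha : a = ι x <;> by_cases hb : b = ι y <;> simp [ha, hb, eq_comm]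
    · intro z _ hz
      simp [hz.symm]
    · simp
  · intro z _ hz
    simp [hz.symm]
  · simp

end Weights

theorem Chord.map_injective {E F : Type} {ι : F → E} (hι : Function.Injective ι) :
    Function.Injective (Chord.map ι) := by
  intro c d h
  cases c; cases d
  simpa [Chord.map, hι.eq_iff] using h

section Definitions

variable {E F : Type} [DecidableEq E] [DecidableEq F] {R : Type*} [CommRing R]

/-- The contribution of a chord to the weight matrix of a Gauss diagram. -/
def Chord.weight (s t : Rˣ) (c : Chord E) : Matrix E E R :=
  Matrix.single c.overEnd c.overEnd (((s ^ (c.sign : ℤ) : Rˣ) : R) - 1) +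
    Matrix.single c.underEnd c.underEnd (((t ^ (c.sign : ℤ) : Rˣ) : R) - 1) +
    Matrix.single c.underEnd c.overEnd (1 - (((s * t) ^ (c.sign : ℤ) : Rˣ) : R))

theorem Chord.weight_map [Fintype F] (s t : Rˣ) (ι : F → E) (c : Chord F) :
    (c.map ι).weight s t = incidence R ι * c.weight s t * (incidence R ι)ᵀ := by
  simp only [Chord.weight, Chord.map, Matrix.mul_add, Matrix.add_mul,
    incidence_mul_single_mul_transpose]

theorem Chord.weight_apply_eq_zero_left (s t : Rˣ) (c : Chord E) (x y : E)
    (ho : c.overEnd ≠ x) (hu : c.underEnd ≠ x) : c.weight s t x y = 0 := by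
  simp [Chord.weight, ho, hu]

theorem Chord.weight_apply_eq_zero_right (s t : Rˣ) (c : Chord E) (x y : E)
    (ho : c.overEnd ≠ y) (hu : c.underEnd ≠ y) : c.weight s t x y = 0 := by
  simp [Chord.weight, ho, hu]

/-- The sum of the weights of a set of chords. -/
def weightSum (s t : Rˣ) (S : Set (Chord E)) : Matrix E E R := ∑ᶠ c ∈ S, c.weight s t

instance Chord.instFinite [Finite E] : Finite (Chord E) :=
  Finite.of_injective (fun c : Chord E => (c.overEnd, c.underEnd, c.sign)) fun c d h => by
    cases c; cases d; simpa using h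

theorem weightSum_union [Finite E] (s t : Rˣ) {S T : Set (Chord E)} (h : Disjoint S T) :
    weightSum s t (S ∪ T) = weightSum s t S + weightSum s t T :=
  finsum_mem_union h S.toFinite T.toFinite

theorem weightSum_image_map [Fintype F] [Fintype E] (s t : Rˣ) {ι : F → E}
    (hι : Function.Injective ι) (S : Set (Chord F)) :
    weightSum s t (Chord.map ι '' S) =
      incidence R ι * weightSum s t S * (incidence R ι)ᵀ := by
  rw [weightSum, finsum_mem_image (Chord.map_injective hι).injOn, weightSum]
  simp only [Chord.weight_map]
  let φ : Matrix F F R →+ Matrix E E R :=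
    { toFun := fun A => incidence R ι * A * (incidence R ι)ᵀ
      map_zero' := by simp
      map_add' := fun A B => by simp [Matrix.mul_add, Matrix.add_mul] }
  exact (φ.map_finsum_mem _ S.toFinite).symm

theorem weightSum_apply [Finite E] (s t : Rˣ) (S : Set (Chord E)) (x y : E) :
    weightSum s t S x y = ∑ᶠ c ∈ S, c.weight s t x y := by
  let φ : Matrix E E R →+ R :=
    { toFun := fun A => A x y
      map_zero' := rfl
      map_add' := fun A B => rfl }
  exact φ.map_finsum_mem _ S.toFinite

theorem weightSum_apply_eq_zero_left [Finite E] (s t : Rˣ) (S : Set (Chord E)) (x y : E)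
    (h : ∀ c ∈ S, c.overEnd ≠ x ∧ c.underEnd ≠ x) : weightSum s t S x y = 0 := by
  rw [weightSum_apply]
  exact finsum_mem_eq_zero_of_forall_eq_zero fun c hc =>
    c.weight_apply_eq_zero_left s t x y (h c hc).1 (h c hc).2

theorem weightSum_apply_eq_zero_right [Finite E] (s t : Rˣ) (S : Set (Chord E)) (x y : E)
    (h : ∀ c ∈ S, c.overEnd ≠ y ∧ c.underEnd ≠ y) : weightSum s t S x y = 0 := by
  rw [weightSum_apply]
  exact finsum_mem_eq_zero_of_forall_eq_zero fun c hc =>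
    c.weight_apply_eq_zero_right s t x y (h c hc).1 (h c hc).2

namespace GaussDiagram

/-- The coefficient matrix of the Alexander system of a Gauss diagram: the unknowns are attached to
the arcs that leave the points, and the equation at a point expresses the unknown of the incoming
arc. -/
def alexanderMatrix (s t : Rˣ) (G : GaussDiagram E) : Matrix E E R :=
  1 + weightSum s t G.chords - (G.next⁻¹).permMatrix R

/-- The determinant of the Alexander system. -/
def alexanderDet [Fintype E] (s t : Rˣ) (G : GaussDiagram E) : R := (G.alexanderMatrix s t).det

end GaussDiagram

end Definitions

/-! ### Gaussian elimination inside a local part -/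

section LocalElimination

variable {E κ R : Type*} [Fintype E] [DecidableEq E] [Fintype κ] [DecidableEq κ] [CommRing R]

/-- Gaussian elimination of the unknowns that are internal to a part of a diagram. -/
theorem det_add_local {Ja Jb : Matrix E κ R} {Ka Kb : Matrix κ E R} {Z : Matrix E E R}
    (hbb : Kb * Jb = 1) (hba : Kb * Ja = 0) (haa : Ka * Ja = 1)
    (hKZ : Kb * Z = -Ka) (hZJ : Z * Ja = -Jb) {A B C D N : Matrix κ κ R} (hN : (1 - C) * N = 1) :
    (Z + Ja * A * Ka + Ja * B * Kb + Jb * C * Ka + Jb * D * Kb).det =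
      (1 - C).det * (Z + Ja * (B + A * N * D) * Kb).det := by
  have hN' : N * (1 - C) = 1 := mul_eq_one_comm.1 hN
  set M := Z + Ja * A * Ka + Ja * B * Kb + Jb * C * Ka + Jb * D * Kb with hM
  have hNC : N * C = N - 1 := by
    rw [Matrix.mul_sub, Matrix.mul_one] at hN'
    rw [← hN']; abel
  have hCN : C * N = N - 1 := by
    rw [Matrix.sub_mul, Matrix.one_mul] at hN
    rw [← hN]; abel
  -- The rows at the second points say (1 - C) v_a = D v_b, so v_a = N D v_b. Substituting into the
  -- rows at the first points gives B + A N D.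
  have hKM : Kb * M = -Ka + C * Ka + D * Kb := by
    simp only [hM, Matrix.mul_add, ← Matrix.mul_assoc, hKZ, hba, hbb]
    simp
  -- A row operation adds multiples of the second rows to the first rows and kills A; it is
  -- unipotent because `Kb * Ja = 0`.
  have h1 : (1 + Ja * (A * N) * Kb) * M = Z + Ja * (B + A * N * D) * Kb + Jb * C * Ka
      + Jb * D * Kb := by
    rw [Matrix.add_mul, Matrix.one_mul, Matrix.mul_assoc _ Kb M, hKM]
    simp only [Matrix.mul_add, Matrix.add_mul, Matrix.mul_assoc]
    rw [← Matrix.mul_assoc N C, hNC, hM]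
    simp only [Matrix.mul_assoc, Matrix.sub_mul, Matrix.mul_sub, Matrix.mul_neg, Matrix.one_mul]
    abel
  have h2 : (Z + Ja * (B + A * N * D) * Kb + Jb * C * Ka + Jb * D * Kb) * Ja
      = -Jb + Jb * C := by
    simp only [Matrix.add_mul, Matrix.mul_assoc, hZJ, hba, haa]
    simp
  -- The matching column operation kills D.
  have h3 : (1 + Ja * (A * N) * Kb) * M * (1 + Ja * (N * D) * Kb) =
      Z + Ja * (B + A * N * D) * Kb + Jb * C * Ka := by
    rw [h1, Matrix.mul_add, Matrix.mul_one, ← Matrix.mul_assoc, ← Matrix.mul_assoc, h2]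
    simp only [Matrix.add_mul, Matrix.mul_assoc, Matrix.neg_mul]
    rw [← Matrix.mul_assoc C N, hCN]
    simp only [Matrix.mul_add, Matrix.sub_mul, Matrix.mul_sub, Matrix.one_mul]
    abel
  -- The remaining C factors out on the left; this is the source of the factor det (1 - C).
  have h4 : (1 - Jb * C * Kb) * (Z + Ja * (B + A * N * D) * Kb) =
      Z + Ja * (B + A * N * D) * Kb + Jb * C * Ka := by
    have h : Kb * (Z + Ja * (B + A * N * D) * Kb) = -Ka := by
      rw [Matrix.mul_add, hKZ, ← Matrix.mul_assoc, ← Matrix.mul_assoc, hba]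
      simp
    rw [Matrix.sub_mul, Matrix.one_mul, Matrix.mul_assoc _ Kb, h]
    simp
  have hd : ∀ X : Matrix κ κ R, (1 + Ja * X * Kb).det = 1 := by
    intro X
    rw [Matrix.det_one_add_mul_comm, ← Matrix.mul_assoc, hba]
    simp
  have hd' : (1 - Jb * C * Kb).det = (1 - C).det := by
    rw [Matrix.det_one_sub_mul_comm, ← Matrix.mul_assoc, hbb, Matrix.one_mul]
  have := congrArg Matrix.det (h3.trans h4.symm)
  rwa [Matrix.det_mul, Matrix.det_mul, Matrix.det_mul, hd, hd, hd', one_mul, mul_one] at this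

end LocalElimination
end VirtualKnot
end

/-! ### Dependence of the determinant on a local part -/

noncomputable section
namespace VirtualKnot

open Matrix

theorem permMatrix_inv_apply {E R : Type*} [DecidableEq E] [Zero R] [One R] (σ : Equiv.Perm E)
    (x y : E) : (σ⁻¹).permMatrix R x y = if x = σ y then 1 else 0 := by
  have h : y = σ.symm x ↔ x = σ y := by rw [eq_comm, Equiv.symm_apply_eq]
  simp [PEquiv.toMatrix_apply, ← h, eq_comm]

namespace GaussDiagram

variable {E κ : Type} [Fintype E] [DecidableEq E] [Fintype κ] [DecidableEq κ]
  {R : Type*} [CommRing R]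

/-- The part of the Alexander matrix that a change of the local part of a diagram preserves. -/
def outerMatrix (s t : Rˣ) (next : Equiv.Perm E) (ι : κ ⊕ κ → E) (rest : Set (Chord E)) :
    Matrix E E R :=
  1 - incidence R ι * (incidence R ι)ᵀ + weightSum s t rest - (next⁻¹).permMatrix R

theorem incidence_transpose_mul_incidence {I J : Type*} (ι : I → E) (ι' : J → E) :
    (incidence R ι)ᵀ * incidence R ι' = (1 : Matrix E E R).submatrix ι ι' := by
  rw [incidence_transpose_mul]
  rfl

theorem incidence_transpose_mul_self {I : Type*} [DecidableEq I] {ι : I → E}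
    (hι : Function.Injective ι) : (incidence R ι)ᵀ * incidence R ι = 1 := by
  rw [incidence_transpose_mul_incidence]
  exact Matrix.submatrix_one _ hι

theorem incidence_sum_mul_mul_transpose (ι : κ ⊕ κ → E) (X : Matrix (κ ⊕ κ) (κ ⊕ κ) R) :
    incidence R ι * X * (incidence R ι)ᵀ =
      incidence R (ι ∘ Sum.inl) * X.toBlocks₁₁ * (incidence R (ι ∘ Sum.inl))ᵀ +
      incidence R (ι ∘ Sum.inl) * X.toBlocks₁₂ * (incidence R (ι ∘ Sum.inr))ᵀ +
      incidence R (ι ∘ Sum.inr) * X.toBlocks₂₁ * (incidence R (ι ∘ Sum.inl))ᵀ +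
      incidence R (ι ∘ Sum.inr) * X.toBlocks₂₂ * (incidence R (ι ∘ Sum.inr))ᵀ := by
  ext x y
  simp only [Matrix.mul_apply, Matrix.add_apply, Fintype.sum_sum_type, incidence,
    Matrix.transpose_apply, Matrix.submatrix_apply, Matrix.toBlocks₁₁,
    Matrix.toBlocks₁₂, Matrix.toBlocks₂₁, Matrix.toBlocks₂₂, Matrix.of_apply, add_mul,
    Finset.sum_add_distrib]
  rw [add_assoc, add_assoc, add_assoc]
  rfl

/-- The Alexander determinant depends on the local part of a diagram only through the transition
matrix of this part. -/
theorem alexanderDet_eq_of_local (s t : Rˣ) (G : GaussDiagram E) {ι : κ ⊕ κ → E}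
    (hι : Function.Injective ι) (hnext : ∀ i, G.next (ι (Sum.inl i)) = ι (Sum.inr i))
    {rest : Set (Chord E)} {loc : Set (Chord (κ ⊕ κ))}
    (hrest : ∀ c ∈ rest, ∀ i, c.overEnd ≠ ι i ∧ c.underEnd ≠ ι i)
    (hG : G.chords = rest ∪ Chord.map ι '' loc)
    {X : Matrix (κ ⊕ κ) (κ ⊕ κ) R} (hX : weightSum s t loc = X) {N : Matrix κ κ R}
    (hN : (1 - X.toBlocks₂₁) * N = 1) :
    G.alexanderDet s t = (1 - X.toBlocks₂₁).det *
      (outerMatrix s t G.next ι rest + incidence R (ι ∘ Sum.inl) *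
        (X.toBlocks₁₂ + (1 + X.toBlocks₁₁) * N * (1 + X.toBlocks₂₂)) *
          (incidence R (ι ∘ Sum.inr))ᵀ).det := by
  have hdis : Disjoint rest (Chord.map ι '' loc) := by
    rw [Set.disjoint_left]
    rintro _ hc ⟨c, -, rfl⟩
    exact (hrest _ hc c.overEnd).1 rfl
  have hM : G.alexanderMatrix s t = outerMatrix s t G.next ι rest +
      incidence R (ι ∘ Sum.inl) * (1 + X.toBlocks₁₁) * (incidence R (ι ∘ Sum.inl))ᵀ +
      incidence R (ι ∘ Sum.inl) * X.toBlocks₁₂ * (incidence R (ι ∘ Sum.inr))ᵀ +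
      incidence R (ι ∘ Sum.inr) * X.toBlocks₂₁ * (incidence R (ι ∘ Sum.inl))ᵀ +
      incidence R (ι ∘ Sum.inr) * (1 + X.toBlocks₂₂) * (incidence R (ι ∘ Sum.inr))ᵀ := by
    rw [alexanderMatrix, outerMatrix, hG, weightSum_union s t hdis, weightSum_image_map s t hι, hX,
      incidence_sum_mul_mul_transpose]
    have h1 := incidence_sum_mul_mul_transpose ι (1 : Matrix (κ ⊕ κ) (κ ⊕ κ) R)
    rw [Matrix.mul_one] at h1
    rw [h1, ← Matrix.fromBlocks_one]
    simp only [Matrix.toBlocks_fromBlocks₁₁, Matrix.toBlocks_fromBlocks₁₂,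
      Matrix.toBlocks_fromBlocks₂₁, Matrix.toBlocks_fromBlocks₂₂, Matrix.mul_zero, Matrix.zero_mul,
      Matrix.mul_add, Matrix.add_mul]
    abel
  -- The diagonal of `outerMatrix` is cleared at the local points and `rest` avoids them, so their
  -- rows and columns keep only the successor entries. This gives the relations `Kb * Z = -Ka` and
  -- `Z * Ja = -Jb` of `det_add_local`.
  have hZ : ∀ i y, outerMatrix s t G.next ι rest (ι i) y =
      -(if G.next y = ι i then (1 : R) else 0) := by
    intro i y
    have h1 : (1 - incidence R ι * (incidence R ι)ᵀ : Matrix E E R) (ι i) y = 0 := by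
      have : (incidence R ι)ᵀ * (1 - incidence R ι * (incidence R ι)ᵀ) = 0 := by
        rw [Matrix.mul_sub, Matrix.mul_one, ← Matrix.mul_assoc, incidence_transpose_mul_self hι,
          Matrix.one_mul, sub_self]
      rw [incidence_transpose_mul] at this
      exact congrFun (congrFun this i) y
    have h2 := weightSum_apply_eq_zero_left s t rest (ι i) y fun c hc => hrest c hc i
    rw [outerMatrix, Matrix.sub_apply, Matrix.add_apply, h1, h2, permMatrix_inv_apply, zero_add,
      zero_sub, if_congr eq_comm rfl rfl]
  have hZ' : ∀ x i, outerMatrix s t G.next ι rest x (ι i) =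
      -(if x = G.next (ι i) then (1 : R) else 0) := by
    intro x i
    have h1 : (1 - incidence R ι * (incidence R ι)ᵀ : Matrix E E R) x (ι i) = 0 := by
      have : (1 - incidence R ι * (incidence R ι)ᵀ) * incidence R ι = 0 := by
        rw [Matrix.sub_mul, Matrix.one_mul, Matrix.mul_assoc, incidence_transpose_mul_self hι,
          Matrix.mul_one, sub_self]
      rw [mul_incidence] at this
      exact congrFun (congrFun this x) i
    have h2 := weightSum_apply_eq_zero_right s t rest x (ι i) fun c hc => hrest c hc i
    rw [outerMatrix, Matrix.sub_apply, Matrix.add_apply, h1, h2, permMatrix_inv_apply, zero_add,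
      zero_sub]
  rw [alexanderDet, hM]
  refine det_add_local (incidence_transpose_mul_self (hι.comp Sum.inr_injective)) ?_
    (incidence_transpose_mul_self (hι.comp Sum.inl_injective)) ?_ ?_ hN
  · rw [incidence_transpose_mul_incidence]
    ext i j
    simp [hι.eq_iff]
  · rw [incidence_transpose_mul]
    ext i y
    simp only [Matrix.submatrix_apply, Function.comp, id, hZ, Matrix.neg_apply,
      Matrix.transpose_apply, incidence_apply]
    simp only [← hnext, G.next.injective.eq_iff]
  · rw [mul_incidence]
    ext x i
    simp only [Matrix.submatrix_apply, Function.comp, id, hZ', Matrix.neg_apply,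
      incidence_apply, hnext]

/-- Two diagrams that differ in a local part with the same transition matrix have proportional
Alexander determinants. -/
theorem alexanderDet_local_congr (s t : Rˣ) {G G' : GaussDiagram E} (hGG : G'.next = G.next)
    {ι : κ ⊕ κ → E}
    (hι : Function.Injective ι) (hnext : ∀ i, G.next (ι (Sum.inl i)) = ι (Sum.inr i))
    {rest : Set (Chord E)} {loc loc' : Set (Chord (κ ⊕ κ))}
    (hrest : ∀ c ∈ rest, ∀ i, c.overEnd ≠ ι i ∧ c.underEnd ≠ ι i)
    (hG : G.chords = rest ∪ Chord.map ι '' loc) (hG' : G'.chords = rest ∪ Chord.map ι '' loc')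
    {X X' : Matrix (κ ⊕ κ) (κ ⊕ κ) R} (hX : weightSum s t loc = X) (hX' : weightSum s t loc' = X')
    {N N' : Matrix κ κ R} (hN : (1 - X.toBlocks₂₁) * N = 1) (hN' : (1 - X'.toBlocks₂₁) * N' = 1)
    (h : X.toBlocks₁₂ + (1 + X.toBlocks₁₁) * N * (1 + X.toBlocks₂₂) =
      X'.toBlocks₁₂ + (1 + X'.toBlocks₁₁) * N' * (1 + X'.toBlocks₂₂)) :
    (1 - X'.toBlocks₂₁).det * G.alexanderDet s t =
      (1 - X.toBlocks₂₁).det * G'.alexanderDet s t := by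
  rw [alexanderDet_eq_of_local s t G hι hnext hrest hG hX hN,
    alexanderDet_eq_of_local s t G' hι (by rwa [hGG]) hrest hG' hX' hN', h, hGG]
  ring

end GaussDiagram
end VirtualKnot
end

/-! ### First and second Reidemeister moves -/

noncomputable section
namespace VirtualKnot

open Matrix

namespace GaussDiagram

theorem ends_ne {E : Type} (G : GaussDiagram E) {c d : Chord E} (hc : c ∈ G.chords)
    (hd : d ∈ G.chords) (h : c ≠ d) : (c.overEnd ≠ d.overEnd ∧ c.overEnd ≠ d.underEnd) ∧
      (c.underEnd ≠ d.overEnd ∧ c.underEnd ≠ d.underEnd) :=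
  ⟨⟨fun h' => h (G.over_inj c hc d hd h'), G.over_ne_under c hc d hd⟩,
    ⟨(G.over_ne_under d hd c hc).symm, fun h' => h (G.under_inj c hc d hd h')⟩⟩

variable {E : Type} [DecidableEq E] {R : Type*} [CommRing R]

theorem weightSum_empty (s t : Rˣ) : weightSum s t (∅ : Set (Chord E)) = (0 : Matrix E E R) :=
  finsum_mem_empty

theorem weightSum_singleton (s t : Rˣ) (c : Chord E) : weightSum s t {c} = c.weight s t :=
  finsum_mem_singleton

theorem weightSum_pair (s t : Rˣ) {c d : Chord E} (h : c ≠ d) :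
    weightSum s t {c, d} = c.weight s t + d.weight s t :=
  finsum_mem_pair h

theorem weightSum_triple [Finite E] (s t : Rˣ) {c d e : Chord E} (h : c ≠ d) (h' : c ≠ e) (h'' : d ≠ e) :
    weightSum s t {c, d, e} = c.weight s t + (d.weight s t + e.weight s t) := by
  rw [weightSum, finsum_mem_insert _ (by simp [h, h']) (Set.toFinite _), finsum_mem_pair h'']

theorem toBlocks_zero {m n l o : Type*} :
    (0 : Matrix (m ⊕ n) (l ⊕ o) R).toBlocks₁₁ = 0 ∧ (0 : Matrix (m ⊕ n) (l ⊕ o) R).toBlocks₁₂ = 0 ∧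
    (0 : Matrix (m ⊕ n) (l ⊕ o) R).toBlocks₂₁ = 0 ∧ (0 : Matrix (m ⊕ n) (l ⊕ o) R).toBlocks₂₂ = 0 :=
  ⟨rfl, rfl, rfl, rfl⟩

/-- A kink and a plain arc both have transition 1. The order of the two ends decides whether the
eliminated unknown occurs in its own equation, and this is the only source of the indeterminacy by
powers of st. -/
theorem alexanderDet_reidemeister1 [Fintype E] (s t : Rˣ) {G G' : GaussDiagram E} (h : G.IsReidemeister1 G') :
    ∃ m : ℤ, G'.alexanderDet s t = (((s * t) ^ m : Rˣ) : R) * G.alexanderDet s t := by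
  obtain ⟨hn, x, hx, hG', hx'⟩ := h
  have hxG : x ∈ G'.chords := by simp [hG']
  have hxx : x.overEnd ≠ x.underEnd := G'.over_ne_under x hxG x hxG
  have hrest : ∀ c ∈ G.chords, (c.overEnd ≠ x.overEnd ∧ c.overEnd ≠ x.underEnd) ∧
      (c.underEnd ≠ x.overEnd ∧ c.underEnd ≠ x.underEnd) := fun c hc =>
    G'.ends_ne (by simp [hG', hc]) hxG (fun h => hx (h ▸ hc))
  -- Naming the powers treats both signs at once: only the invertibility of S and T is used.
  obtain ⟨S, hS⟩ : ∃ S, S = s ^ (x.sign : ℤ) := ⟨_, rfl⟩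
  obtain ⟨T, hT⟩ : ∃ T, T = t ^ (x.sign : ℤ) := ⟨_, rfl⟩
  have hS' : (S : R) * ((S⁻¹ : Rˣ) : R) = 1 := S.mul_inv
  have hT' : (T : R) * ((T⁻¹ : Rˣ) : R) = 1 := T.mul_inv
  rcases hx' with hx' | hx'
  -- Over-end first: the under-end equation contains the inner unknown with coefficient 1 - ST, so 1
  -- - C = ST = (st)^ε.
  · refine ⟨x.sign, ?_⟩
    have := alexanderDet_local_congr s t hn (κ := Unit)
      (ι := Sum.elim (fun _ => x.overEnd) (fun _ => x.underEnd)) (rest := G.chords) (loc := ∅)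
      (loc' := {⟨Sum.inl (), Sum.inr (), x.sign⟩})
      (by rintro (_ | _) (_ | _) <;> simp [hxx, hxx.symm]) (by simpa using hx')
      (by rintro c hc (_ | _) <;> simp [hrest c hc]) (by simp)
      (by rw [hG', Set.image_singleton]; rfl) (weightSum_empty s t) (weightSum_singleton s t _)
      (N := 1) (N' := Matrix.of fun _ _ => (((S * T)⁻¹ : Rˣ) : R)) (by simp [toBlocks_zero]) (by
        ext
        simp [Matrix.mul_apply, Chord.weight, Matrix.toBlocks₂₁, mul_zpow, ← hS, ← hT]
        linear_combination hS' + (S : R) * ((S⁻¹ : Rˣ) : R) * hT') (by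
        ext
        simp [Matrix.mul_apply, Chord.weight, Matrix.toBlocks₁₁, Matrix.toBlocks₁₂,
          Matrix.toBlocks₂₂, mul_zpow, ← hS, ← hT]
        linear_combination -hS' - (S : R) * ((S⁻¹ : Rˣ) : R) * hT')
    simpa [Chord.weight, Matrix.toBlocks₂₁] using this.symm
  -- Under-end first: C = 0, and the transition is (1 - ST) + T S = 1.
  · refine ⟨0, ?_⟩
    have := alexanderDet_local_congr s t hn (κ := Unit)
      (ι := Sum.elim (fun _ => x.underEnd) (fun _ => x.overEnd)) (rest := G.chords) (loc := ∅)
      (loc' := {⟨Sum.inr (), Sum.inl (), x.sign⟩})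
      (by rintro (_ | _) (_ | _) <;> simp [hxx, hxx.symm]) (by simpa using hx')
      (by rintro c hc (_ | _) <;> simp [hrest c hc]) (by simp)
      (by rw [hG', Set.image_singleton]; rfl) (weightSum_empty s t) (weightSum_singleton s t _)
      (N := 1) (N' := 1) (by simp [toBlocks_zero]) (by
        ext
        simp [Chord.weight, Matrix.toBlocks₂₁]) (by
        ext
        simp [Matrix.mul_apply, Chord.weight, Matrix.toBlocks₁₁, Matrix.toBlocks₁₂,
          Matrix.toBlocks₂₂, mul_zpow, ← hS, ← hT]
        try ring)
    simpa [Chord.weight, Matrix.toBlocks₂₁] using this.symm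

theorem alexanderDet_reidemeister2 [Fintype E] (s t : Rˣ) {G G' : GaussDiagram E} (h : G.IsReidemeister2 G') :
    G'.alexanderDet s t = G.alexanderDet s t := by
  obtain ⟨hn, x, y, hxy, hx, hy, hG', hs, ho, hu⟩ := h
  have hxG : x ∈ G'.chords := by simp [hG']
  have hyG : y ∈ G'.chords := by simp [hG']
  have hxx : x.overEnd ≠ x.underEnd := G'.over_ne_under x hxG x hxG
  have hyy : y.overEnd ≠ y.underEnd := G'.over_ne_under y hyG y hyG
  obtain ⟨⟨h1, h2⟩, h3, h4⟩ := G'.ends_ne hxG hyG hxy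
  have hrestx : ∀ c ∈ G.chords, (c.overEnd ≠ x.overEnd ∧ c.overEnd ≠ x.underEnd) ∧
      (c.underEnd ≠ x.overEnd ∧ c.underEnd ≠ x.underEnd) := fun c hc =>
    G'.ends_ne (by simp [hG', hc]) hxG (fun h => hx (h ▸ hc))
  have hresty : ∀ c ∈ G.chords, (c.overEnd ≠ y.overEnd ∧ c.overEnd ≠ y.underEnd) ∧
      (c.underEnd ≠ y.overEnd ∧ c.underEnd ≠ y.underEnd) := fun c hc =>
    G'.ends_ne (by simp [hG', hc]) hyG (fun h => hy (h ▸ hc))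
  obtain ⟨S, hS⟩ : ∃ S, S = s ^ (y.sign : ℤ) := ⟨_, rfl⟩
  obtain ⟨T, hT⟩ : ∃ T, T = t ^ (y.sign : ℤ) := ⟨_, rfl⟩
  have hS' : (S : R) * ((S⁻¹ : Rˣ) : R) = 1 := S.mul_inv
  have hT' : (T : R) * ((T⁻¹ : Rˣ) : R) = 1 := T.mul_inv
  rcases hu with hu | hu
  -- Parallel strands: each chord joins points of the same level, so C = 0.
  · have := alexanderDet_local_congr s t hn (κ := Fin 2)
      (ι := Sum.elim ![x.overEnd, x.underEnd] ![y.overEnd, y.underEnd]) (rest := G.chords)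
      (loc := ∅)
      (loc' := {⟨Sum.inl 0, Sum.inl 1, -y.sign⟩, ⟨Sum.inr 0, Sum.inr 1, y.sign⟩})
      (by
        rintro (i | i) (j | j) <;> fin_cases i <;> fin_cases j <;>
          simp [hxx, hyy, hxx.symm, hyy.symm, h1, h2, h3, h4, h1.symm, h2.symm, h3.symm, h4.symm])
      (by intro i; fin_cases i <;> simp [ho, hu])
      (by
        rintro c hc (i | i) <;> fin_cases i <;> simp [hrestx c hc, hresty c hc]) (by simp)
      (by rw [hG', Set.image_pair, ← hs]; rfl) (weightSum_empty s t)
      (weightSum_pair s t (by simp)) (N := 1) (N' := 1) (by simp [toBlocks_zero])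
      (by
        ext i j
        fin_cases i <;> fin_cases j <;>
          simp [Matrix.mul_apply, Fin.sum_univ_two, Chord.weight, Matrix.toBlocks₂₁])
      (by
        ext i j
        fin_cases i <;> fin_cases j <;>
          simp [Matrix.mul_apply, Fin.sum_univ_two, Chord.weight, Matrix.toBlocks₁₁,
            Matrix.toBlocks₁₂, Matrix.toBlocks₂₂, mul_zpow, ← hS, ← hT] <;> grind)
    simpa [Chord.weight, Matrix.toBlocks₂₁, Matrix.det_fin_two, toBlocks_zero] using this.symm
  -- Antiparallel strands: the chord `x` runs from the first point of the over-strand to the second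
  -- point of the under-strand. So C has a single off-diagonal entry, and (1 - C)⁻¹ = 1 + C with
  -- determinant 1.
  · have := alexanderDet_local_congr s t hn (κ := Fin 2)
      (ι := Sum.elim ![x.overEnd, y.underEnd] ![y.overEnd, x.underEnd]) (rest := G.chords)
      (loc := ∅)
      (loc' := {⟨Sum.inl 0, Sum.inr 1, -y.sign⟩, ⟨Sum.inr 0, Sum.inl 1, y.sign⟩})
      (by
        rintro (i | i) (j | j) <;> fin_cases i <;> fin_cases j <;>
          simp [hxx, hyy, hxx.symm, hyy.symm, h1, h2, h3, h4, h1.symm, h2.symm, h3.symm, h4.symm])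
      (by intro i; fin_cases i <;> simp [ho, hu])
      (by
        rintro c hc (i | i) <;> fin_cases i <;> simp [hrestx c hc, hresty c hc]) (by simp)
      (by rw [hG', Set.image_pair, ← hs]; rfl) (weightSum_empty s t)
      (weightSum_pair s t (by simp)) (N := 1)
      (N' := 1 + Matrix.single 1 0 (1 - (((S * T)⁻¹ : Rˣ) : R))) (by simp [toBlocks_zero])
      (by
        ext i j
        fin_cases i <;> fin_cases j <;>
          simp [Matrix.mul_apply, Fin.sum_univ_two, Chord.weight, Matrix.toBlocks₂₁, mul_zpow,
            ← hS, ← hT])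
      (by
        ext i j
        fin_cases i <;> fin_cases j <;>
          simp [Matrix.mul_apply, Fin.sum_univ_two, Chord.weight, Matrix.toBlocks₁₁,
            Matrix.toBlocks₁₂, Matrix.toBlocks₂₂, mul_zpow, ← hS, ← hT] <;> grind)
    simpa [Chord.weight, Matrix.toBlocks₂₁, Matrix.det_fin_two, toBlocks_zero] using this.symm

end GaussDiagram
end VirtualKnot
end

/-! ### Third Reidemeister move -/

noncomputable section
namespace VirtualKnot

open Matrix

namespace GaussDiagram

/-- The position on its strand of one of the two crossings of a strand in a triangle: the first
point of the strand is `Sum.inl`, the second is `Sum.inr`. -/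
def trianglePosition (o : Fin 3 → ℤˣ) (i : Fin 3) (u : ℤˣ) : Fin 3 ⊕ Fin 3 :=
  if o i = u then Sum.inl i else Sum.inr i

/-- The chords of a triangle, before (`u = 1`) or after (`u = -1`) the third Reidemeister move. -/
def triangleChord (o : Fin 3 → ℤˣ) (κ u : ℤˣ) (i j : Fin 3) (ui uj : ℤˣ) : Chord (Fin 3 ⊕ Fin 3) :=
  ⟨trianglePosition o i (u * ui), trianglePosition o j (u * uj), κ * o i * o j⟩

variable {E : Type} [DecidableEq E] {R : Type*} [CommRing R]

/-- The weight matrix of a triangle. -/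
def triangleWeight (s t : Rˣ) (o : Fin 3 → ℤˣ) (κ u : ℤˣ) :
    Matrix (Fin 3 ⊕ Fin 3) (Fin 3 ⊕ Fin 3) R :=
  (triangleChord o κ u 0 1 1 1).weight s t + ((triangleChord o κ u 0 2 (-1) 1).weight s t +
    (triangleChord o κ u 1 2 (-1) (-1)).weight s t)

/-- Reversing the order of the crossings on every strand negates all three orders and keeps the
signs, which are products of two orders and κ. The move thus becomes the symmetry o ↦ -o. -/
theorem triangleWeight_neg (s t : Rˣ) (o : Fin 3 → ℤˣ) (κ : ℤˣ) :
    triangleWeight (R := R) s t o κ (-1) = triangleWeight s t (-o) κ 1 := by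
  simp [triangleWeight, triangleChord, trianglePosition, neg_eq_iff_eq_neg]

/-- Chords always lead from a higher strand to a lower one, and with the strands numbered from the
top this makes C strictly lower triangular. Hence C is nilpotent and det (1 - C) = 1 on both sides
of the move. -/
theorem toBlocks₂₁_triangleWeight (s t : Rˣ) (oT oM oB κ : ℤˣ) :
    ∃ x y z : R, (triangleWeight s t ![oT, oM, oB] κ 1).toBlocks₂₁ =
      !![0, 0, 0; x, 0, 0; y, z, 0] := by
  refine ⟨(triangleWeight s t ![oT, oM, oB] κ 1).toBlocks₂₁ 1 0,
    (triangleWeight s t ![oT, oM, oB] κ 1).toBlocks₂₁ 2 0,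
    (triangleWeight s t ![oT, oM, oB] κ 1).toBlocks₂₁ 2 1, ?_⟩
  rcases Int.units_eq_one_or oT with rfl | rfl <;> rcases Int.units_eq_one_or oM with rfl | rfl <;>
    rcases Int.units_eq_one_or oB with rfl | rfl <;>
  · ext i j
    fin_cases i <;> fin_cases j <;>
      simp [triangleWeight, triangleChord, trianglePosition, Chord.weight, Matrix.toBlocks₂₁]

theorem one_sub_strictLower_mul (x y z : R) :
    (1 - !![0, 0, 0; x, 0, 0; y, z, 0]) *
      (1 + !![0, 0, 0; x, 0, 0; y, z, 0] +
        !![0, 0, 0; x, 0, 0; y, z, 0] * !![0, 0, 0; x, 0, 0; y, z, 0]) =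
      (1 : Matrix (Fin 3) (Fin 3) R) := by
  ext i j
  fin_cases i <;> fin_cases j <;> simp [Matrix.mul_apply, Fin.sum_univ_three] <;> ring

/-- The inverse of `1 - C` when `C ^ 3 = 0`. -/
def triangleInverse (s t : Rˣ) (o : Fin 3 → ℤˣ) (κ : ℤˣ) : Matrix (Fin 3) (Fin 3) R :=
  1 + (triangleWeight s t o κ 1).toBlocks₂₁ +
    (triangleWeight s t o κ 1).toBlocks₂₁ * (triangleWeight s t o κ 1).toBlocks₂₁

theorem one_sub_mul_triangleInverse (s t : Rˣ) (oT oM oB κ : ℤˣ) :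
    (1 - (triangleWeight s t ![oT, oM, oB] κ 1).toBlocks₂₁) *
      triangleInverse s t ![oT, oM, oB] κ = (1 : Matrix (Fin 3) (Fin 3) R) := by
  obtain ⟨x, y, z, h⟩ := toBlocks₂₁_triangleWeight (R := R) s t oT oM oB κ
  rw [triangleInverse, h]
  exact one_sub_strictLower_mul x y z

theorem det_one_sub_triangleWeight (s t : Rˣ) (oT oM oB κ : ℤˣ) :
    (1 - (triangleWeight s t ![oT, oM, oB] κ 1).toBlocks₂₁ : Matrix (Fin 3) (Fin 3) R).det = 1 := by
  obtain ⟨x, y, z, h⟩ := toBlocks₂₁_triangleWeight (R := R) s t oT oM oB κ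
  rw [h, Matrix.det_fin_three]
  simp

/-- The transition matrix of a triangle. -/
def triangleTransition (s t : Rˣ) (o : Fin 3 → ℤˣ) (κ : ℤˣ) : Matrix (Fin 3) (Fin 3) R :=
  (triangleWeight s t o κ 1).toBlocks₁₂ + (1 + (triangleWeight s t o κ 1).toBlocks₁₁) *
    triangleInverse s t o κ * (1 + (triangleWeight s t o κ 1).toBlocks₂₂)

-- An entrywise computation for each choice of the remaining two orders, in which only the
-- invertibility of S = s^κ and T = t^κ is used. The coherence of signs and orders enters here.
set_option maxHeartbeats 4000000 in
theorem triangleTransition_neg_of_eq_one (s t : Rˣ) (oM oB κ : ℤˣ) :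
    triangleTransition (R := R) s t ![1, oM, oB] κ = triangleTransition s t ![-1, -oM, -oB] κ := by
  obtain ⟨S, hS⟩ : ∃ S, S = s ^ (κ : ℤ) := ⟨_, rfl⟩
  obtain ⟨T, hT⟩ : ∃ T, T = t ^ (κ : ℤ) := ⟨_, rfl⟩
  have hS' : (S : R) * ((S⁻¹ : Rˣ) : R) = 1 := S.mul_inv
  have hT' : (T : R) * ((T⁻¹ : Rˣ) : R) = 1 := T.mul_inv
  rcases Int.units_eq_one_or oM with rfl | rfl <;> rcases Int.units_eq_one_or oB with rfl | rfl <;>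
  · ext i j
    fin_cases i <;> fin_cases j <;>
      (simp [triangleTransition, triangleInverse, triangleWeight, triangleChord, trianglePosition,
        Chord.weight, Matrix.toBlocks₁₁, Matrix.toBlocks₁₂, Matrix.toBlocks₂₁, Matrix.toBlocks₂₂,
        Matrix.mul_apply, Fin.sum_univ_three, mul_zpow, ← hS, ← hT]; try grind)

theorem triangleTransition_neg (s t : Rˣ) (oT oM oB κ : ℤˣ) :
    triangleTransition (R := R) s t ![oT, oM, oB] κ = triangleTransition s t ![-oT, -oM, -oB] κ := by
  rcases Int.units_eq_one_or oT with rfl | rfl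
  · exact triangleTransition_neg_of_eq_one s t oM oB κ
  · simpa using (triangleTransition_neg_of_eq_one (R := R) s t (-oM) (-oB) κ).symm

end GaussDiagram
end VirtualKnot
end

noncomputable section
namespace VirtualKnot

open Matrix

theorem units_ne_neg_self (u : ℤˣ) : u ≠ -u := by
  rcases Int.units_eq_one_or u with rfl | rfl <;> decide

namespace GaussDiagram

variable {E : Type} {R : Type*} [CommRing R]

/-- The six points of a triangle with the chords `x`, `y`, `z`. -/
def trianglePoint (x y z : Chord E) (i : Fin 3) (u : ℤˣ) : E :=
  if u = 1 then ![x.overEnd, x.underEnd, y.underEnd] i else ![y.overEnd, z.overEnd, z.underEnd] i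

/-- The embedding of the points of a triangle. -/
def triangleEmbedding (x y z : Chord E) (o : Fin 3 → ℤˣ) : Fin 3 ⊕ Fin 3 → E :=
  Sum.elim (fun i => trianglePoint x y z i (o i)) (fun i => trianglePoint x y z i (-o i))

theorem triangleEmbedding_position (x y z : Chord E) (o : Fin 3 → ℤˣ) (i : Fin 3) (u : ℤˣ) :
    triangleEmbedding x y z o (trianglePosition o i u) = trianglePoint x y z i u := by
  unfold trianglePosition
  split_ifs with h
  · simp [triangleEmbedding, h]
  · have : -o i = u := by
      rcases Int.units_eq_one_or (o i) with h' | h' <;>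
        rcases Int.units_eq_one_or u with rfl | rfl <;> simp_all
    simp [triangleEmbedding, this]

theorem alexanderDet_reidemeister3 [Fintype E] [DecidableEq E] (s t : Rˣ) {G G' : GaussDiagram E}
    (h : G.IsReidemeister3 G') : G'.alexanderDet s t = G.alexanderDet s t := by
  obtain ⟨hn, x, hx, y, hy, z, hz, hxy, hxz, hyz, oT, oM, oB, κ, hT, hM, hB, sx, sy, sz, hG'⟩ := h
  have hxx : x.overEnd ≠ x.underEnd := G.over_ne_under x hx x hx
  have hyy : y.overEnd ≠ y.underEnd := G.over_ne_under y hy y hy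
  have hzz : z.overEnd ≠ z.underEnd := G.over_ne_under z hz z hz
  obtain ⟨⟨a1, a2⟩, a3, a4⟩ := G.ends_ne hx hy hxy
  obtain ⟨⟨b1, b2⟩, b3, b4⟩ := G.ends_ne hx hz hxz
  obtain ⟨⟨c1, c2⟩, c3, c4⟩ := G.ends_ne hy hz hyz
  set σ : Equiv.Perm E := Equiv.swap x.overEnd y.overEnd * Equiv.swap x.underEnd z.overEnd *
        Equiv.swap y.underEnd z.underEnd with hσ
  have hσ' : G'.chords = Chord.map σ '' G.chords := by
    rw [hG', hσ]
    congr!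
  have e1 : σ x.overEnd = y.overEnd := by
    simp [hσ, Equiv.swap_apply_of_ne_of_ne, hxx, a2, b1, b2]
  have e2 : σ y.overEnd = x.overEnd := by
    simp [hσ, Equiv.swap_apply_of_ne_of_ne, hyy, a3.symm, c1, c2]
  have e3 : σ x.underEnd = z.overEnd := by
    simp [hσ, Equiv.swap_apply_of_ne_of_ne, a4, b4, b1.symm, c1.symm]
  have e4 : σ z.overEnd = x.underEnd := by
    simp [hσ, Equiv.swap_apply_of_ne_of_ne, hzz, c3.symm, hxx.symm, a3]
  have e5 : σ y.underEnd = z.underEnd := by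
    simp [hσ, Equiv.swap_apply_of_ne_of_ne, hzz.symm, b2.symm, b4.symm, c2.symm]
  have e6 : σ z.underEnd = y.underEnd := by
    simp [hσ, Equiv.swap_apply_of_ne_of_ne, a2.symm, hyy.symm, a4.symm, c3]
  set o : Fin 3 → ℤˣ := ![oT, oM, oB] with ho
  -- The swaps fix every end of the other chords, so the move changes only the three chords of the
  -- triangle.
  set rest : Set (Chord E) := G.chords \ {x, y, z} with hr
  have hGr : G.chords = rest ∪ {x, y, z} := by
    rw [hr, Set.sdiff_union_of_subset]
    rintro c (rfl | rfl | rfl) <;> assumption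
  have hrest : ∀ c ∈ rest, ∀ i u, c.overEnd ≠ trianglePoint x y z i u ∧
      c.underEnd ≠ trianglePoint x y z i u := by
    rintro c ⟨hc, hc'⟩ i u
    simp only [Set.mem_insert_iff, Set.mem_singleton_iff, not_or] at hc'
    have hcx := G.ends_ne hc hx hc'.1
    have hcy := G.ends_ne hc hy hc'.2.1
    have hcz := G.ends_ne hc hz hc'.2.2
    rcases Int.units_eq_one_or u with rfl | rfl <;> fin_cases i <;>
      simp [trianglePoint, hcx, hcy, hcz]
  have hσrest : Chord.map σ '' rest = rest := by
    have hfix : ∀ e, (∀ i u, e ≠ trianglePoint x y z i u) → σ e = e := by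
      intro e he
      have h1 := he 0 1
      have h2 := he 0 (-1)
      have h3 := he 1 1
      have h4 := he 1 (-1)
      have h5 := he 2 1
      have h6 := he 2 (-1)
      simp [trianglePoint] at h1 h2 h3 h4 h5 h6
      simp [hσ, Equiv.swap_apply_of_ne_of_ne, h1, h2, h3, h4, h5, h6]
    have : ∀ c ∈ rest, c.map σ = c := by
      intro c hc
      have h1 := hfix c.overEnd fun i u => (hrest c hc i u).1
      have h2 := hfix c.underEnd fun i u => (hrest c hc i u).2
      rw [Chord.map, h1, h2]
    rw [Set.image_congr this, Set.image_id']
  have hinj : Function.Injective (triangleEmbedding x y z o) := by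
    have h2 : ∀ i j u v, trianglePoint x y z i u = trianglePoint x y z j v → i = j ∧ u = v := by
      intro i j u v
      rcases Int.units_eq_one_or u with rfl | rfl <;> rcases Int.units_eq_one_or v with rfl | rfl <;>
        fin_cases i <;> fin_cases j <;>
        simp [trianglePoint, hxx, hyy, hzz, hxx.symm, hyy.symm, hzz.symm, a1, a2, a3, a4, b1, b2,
          b3, b4, c1, c2, c3, c4, a1.symm, a2.symm, a3.symm, a4.symm, b1.symm, b2.symm, b3.symm,
          b4.symm, c1.symm, c2.symm, c3.symm, c4.symm]
    rintro (i | i) (j | j) hij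
    · rw [(h2 _ _ _ _ hij).1]
    · obtain ⟨rfl, h⟩ := h2 _ _ _ _ hij
      exact (units_ne_neg_self _ h).elim
    · obtain ⟨rfl, h⟩ := h2 _ _ _ _ hij
      exact (units_ne_neg_self _ h.symm).elim
    · rw [(h2 _ _ _ _ hij).1]
  have hnext : ∀ i, G.next (triangleEmbedding x y z o (Sum.inl i)) =
      triangleEmbedding x y z o (Sum.inr i) := by
    intro i
    fin_cases i
    · rcases hT with ⟨rfl, h⟩ | ⟨rfl, h⟩ <;> simpa [triangleEmbedding, trianglePoint, ho] using h
    · rcases hM with ⟨rfl, h⟩ | ⟨rfl, h⟩ <;> simpa [triangleEmbedding, trianglePoint, ho] using h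
    · rcases hB with ⟨rfl, h⟩ | ⟨rfl, h⟩ <;> simpa [triangleEmbedding, trianglePoint, ho] using h
  have hmap : ∀ u i j ui uj, (triangleChord o κ u i j ui uj).map (triangleEmbedding x y z o) =
      ⟨trianglePoint x y z i (u * ui), trianglePoint x y z j (u * uj), κ * o i * o j⟩ := by
    intro u i j ui uj
    simp [Chord.map, triangleChord, triangleEmbedding_position]
  have hx1 : (triangleChord o κ 1 0 1 1 1).map (triangleEmbedding x y z o) = x := by
    rw [hmap]; simp [trianglePoint, ho, ← sx]
  have hy1 : (triangleChord o κ 1 0 2 (-1) 1).map (triangleEmbedding x y z o) = y := by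
    rw [hmap]; simp [trianglePoint, ho, ← sy]
  have hz1 : (triangleChord o κ 1 1 2 (-1) (-1)).map (triangleEmbedding x y z o) = z := by
    rw [hmap]; simp [trianglePoint, ho, ← sz]
  have hx2 : (triangleChord o κ (-1) 0 1 1 1).map (triangleEmbedding x y z o) = x.map σ := by
    rw [hmap]; simp [Chord.map, e1, e3, trianglePoint, sx, ho]
  have hy2 : (triangleChord o κ (-1) 0 2 (-1) 1).map (triangleEmbedding x y z o) = y.map σ := by
    rw [hmap]; simp [Chord.map, e2, e5, trianglePoint, sy, ho]
  have hz2 : (triangleChord o κ (-1) 1 2 (-1) (-1)).map (triangleEmbedding x y z o) = z.map σ := by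
    rw [hmap]; simp [Chord.map, e4, e6, trianglePoint, sz, ho]
  have hσi := Chord.map_injective σ.injective
  have := alexanderDet_local_congr s t hn hinj hnext (rest := rest)
    (loc := {triangleChord o κ 1 0 1 1 1, triangleChord o κ 1 0 2 (-1) 1,
      triangleChord o κ 1 1 2 (-1) (-1)})
    (loc' := {triangleChord o κ (-1) 0 1 1 1, triangleChord o κ (-1) 0 2 (-1) 1,
      triangleChord o κ (-1) 1 2 (-1) (-1)})
    (by rintro c hc (i | i) <;> exact hrest c hc _ _)
    (by rw [Set.image_insert_eq, Set.image_pair, hx1, hy1, hz1]; exact hGr)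
    (by
      rw [Set.image_insert_eq, Set.image_pair, hx2, hy2, hz2, hσ', hGr, Set.image_union, hσrest,
        Set.image_insert_eq, Set.image_pair])
    (weightSum_triple s t (fun h => hxy (hx1.symm.trans ((congrArg _ h).trans hy1)))
      (fun h => hxz (hx1.symm.trans ((congrArg _ h).trans hz1))) (fun h => hyz (hy1.symm.trans ((congrArg _ h).trans hz1))))
    ((weightSum_triple s t (fun h => hxy (hσi (hx2.symm.trans ((congrArg _ h).trans hy2))))
      (fun h => hxz (hσi (hx2.symm.trans ((congrArg _ h).trans hz2))))
      (fun h => hyz (hσi (hy2.symm.trans ((congrArg _ h).trans hz2))))).trans (triangleWeight_neg s t o κ))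
    (N := triangleInverse s t o κ) (N' := triangleInverse s t (-o) κ)
    (one_sub_mul_triangleInverse s t oT oM oB κ)
    (by
      have := one_sub_mul_triangleInverse (R := R) s t (-oT) (-oM) (-oB) κ
      simpa [ho] using this)
    (by
      have := triangleTransition_neg (R := R) s t oT oM oB κ
      simpa [ho, triangleTransition, triangleWeight] using this)
  have d1 := det_one_sub_triangleWeight (R := R) s t oT oM oB κ
  have d2 := det_one_sub_triangleWeight (R := R) s t (-oT) (-oM) (-oB) κ
  have ho' : -o = ![-oT, -oM, -oB] := by simp [ho]
  rw [ho', d2, one_mul] at this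
  rw [this]
  refine (one_mul _).symm.trans ?_
  rw [← d1]
  rfl

end GaussDiagram
end VirtualKnot
end

/-! ### Relabeling, subdivision, and invariance under virtual isotopy -/

noncomputable section
namespace VirtualKnot

open Matrix

namespace GaussDiagram

variable {E F : Type} {R : Type*} [CommRing R]

theorem alexanderMatrix_apply [DecidableEq E] (s t : Rˣ) (G : GaussDiagram E) (x y : E) :
    G.alexanderMatrix s t x y =
      ((1 : Matrix E E R) x y + weightSum s t G.chords x y) - if x = G.next y then 1 else 0 := by
  rw [alexanderMatrix, Matrix.sub_apply, Matrix.add_apply, permMatrix_inv_apply]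

section

variable [DecidableEq E] [Fintype F] [DecidableEq F]

theorem weightSum_image_map_apply [Fintype E] (s t : Rˣ) {ι : E → F} (hι : Function.Injective ι)
    (S : Set (Chord E)) (x y : E) :
    weightSum (R := R) s t (Chord.map ι '' S) (ι x) (ι y) = weightSum s t S x y := by
  have h : (incidence R ι)ᵀ * weightSum s t (Chord.map ι '' S) * incidence R ι =
      weightSum s t S := by
    rw [weightSum_image_map s t hι, Matrix.mul_assoc, Matrix.mul_assoc,
      incidence_transpose_mul_self hι, Matrix.mul_one, ← Matrix.mul_assoc,
      incidence_transpose_mul_self hι, Matrix.one_mul]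
  rw [incidence_transpose_mul, mul_incidence] at h
  exact congrFun (congrFun h x) y

theorem alexanderDet_relabeling [Fintype E] (s t : Rˣ) {G : GaussDiagram E} {G' : GaussDiagram F}
    (h : G.IsRelabeling G') : G'.alexanderDet s t = (G.alexanderDet s t : R) := by
  obtain ⟨f, hf, hc⟩ := h
  rw [alexanderDet, alexanderDet, ← Matrix.det_submatrix_equiv_self f]
  congr 1
  ext x y
  rw [Matrix.submatrix_apply, alexanderMatrix_apply, alexanderMatrix_apply, hc,
    weightSum_image_map_apply s t f.injective, hf]
  simp only [Matrix.one_apply, f.injective.eq_iff]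

/-- The equation at a plain point equates its incoming and outgoing unknowns. Eliminating the
outgoing one is a Schur complement with pivot 1. -/
theorem alexanderDet_subdivision [Fintype E] (s t : Rˣ) {G : GaussDiagram E} {G' : GaussDiagram F}
    (h : G.IsSubdivision G') : G'.alexanderDet s t = (G.alexanderDet s t : R) := by
  obtain ⟨f, d, hf, hr, hd, hn, hc⟩ := h
  have hfd : ∀ e, f e ≠ d := fun e he => by
    have : f e ∈ Set.range f := ⟨e, rfl⟩
    rw [hr] at this
    exact this he
  have hbij : Function.Bijective (Sum.elim f fun _ : Unit => d) := by
    constructor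
    · rintro (x | x) (y | y) h
      · exact congrArg _ (hf h)
      · exact (hfd _ h).elim
      · exact (hfd _ h.symm).elim
      · rfl
    · intro y
      by_cases hy : y = d
      · exact ⟨Sum.inr (), hy.symm⟩
      · have : y ∈ Set.range f := by rw [hr]; exact hy
        obtain ⟨x, rfl⟩ := this
        exact ⟨Sum.inl x, rfl⟩
  have hW : ∀ c ∈ G'.chords, c.overEnd ≠ d ∧ c.underEnd ≠ d := by
    rw [hc]
    rintro _ ⟨c, -, rfl⟩
    exact ⟨hfd _, hfd _⟩
  have hWl := fun y => weightSum_apply_eq_zero_left (R := R) s t G'.chords d y hW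
  have hWr := fun y => weightSum_apply_eq_zero_right (R := R) s t G'.chords y d hW
  -- `B` marks the successor of `d` and `C` its predecessor; in A - B C the product restores the
  -- link between them.
  let B : Matrix E Unit R := Matrix.of fun x _ => -if f x = G'.next d then 1 else 0
  let C : Matrix Unit E R := Matrix.of fun _ y => -if d = G'.next (f y) then 1 else 0
  let A : Matrix E E R := Matrix.of fun x y => G'.alexanderMatrix s t (f x) (f y)
  have hM : (G'.alexanderMatrix s t).submatrix (Equiv.ofBijective _ hbij)
      (Equiv.ofBijective _ hbij) = Matrix.fromBlocks A B C 1 := by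
    ext (x | x) (y | y)
    · rfl
    · simp [alexanderMatrix_apply, hWr, B, hfd]
    · simp [alexanderMatrix_apply, hWl, C, (hfd _).symm]
    · simp [alexanderMatrix_apply, hWl, hd.symm]
  rw [alexanderDet, alexanderDet, ← Matrix.det_submatrix_equiv_self (Equiv.ofBijective _ hbij), hM,
    Matrix.det_fromBlocks_one₂₂]
  congr 1
  ext x y
  have hw : weightSum (R := R) s t G'.chords (f x) (f y) = weightSum s t G.chords x y := by
    rw [hc, weightSum_image_map_apply s t hf]
  rw [Matrix.sub_apply, alexanderMatrix_apply]
  simp only [A, alexanderMatrix_apply, hw, Matrix.mul_apply, B, C, Matrix.of_apply, Finset.univ_unique, Finset.sum_singleton,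
    Matrix.one_apply, hf.eq_iff]
  rcases hn y with h | ⟨h, h'⟩
  · simp [h, hf.eq_iff, (hfd _).symm]
  · simp [h, h', hf.eq_iff, hfd]

end

/-- The determinant of the Alexander system, as a function of the diagram only. -/
def alexanderInvariant (s t : Rˣ) (G : GaussDiagram E) : R :=
  haveI := G.finite
  @alexanderDet E (Classical.decEq E) R _ (Fintype.ofFinite E) s t G

theorem alexanderInvariant_eq [Fintype E] [DecidableEq E] (s t : Rˣ) (G : GaussDiagram E) :
    G.alexanderInvariant s t = (G.alexanderDet s t : R) := by
  unfold alexanderInvariant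
  congr!

end GaussDiagram

/-- The Alexander determinant of a virtual link is well defined up to powers of `s * t`. -/
theorem VirtuallyIsotopic.alexanderInvariant_eq {R : Type*} [CommRing R] (s t : Rˣ) {E F : Type}
    {G : GaussDiagram E} {G' : GaussDiagram F} (h : VirtuallyIsotopic G G') :
    ∃ m : ℤ, G'.alexanderInvariant s t =
      (((s * t) ^ m : Rˣ) : R) * G.alexanderInvariant s t := by
  classical
  induction h with
  | refl G => exact ⟨0, by simp⟩
  | symm _ ih =>
    obtain ⟨m, hm⟩ := ih
    refine ⟨-m, ?_⟩
    rw [hm, ← mul_assoc, ← Units.val_mul, ← _root_.zpow_add]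
    simp
  | trans _ _ ih ih' =>
    obtain ⟨m, hm⟩ := ih
    obtain ⟨m', hm'⟩ := ih'
    refine ⟨m' + m, ?_⟩
    rw [hm', hm, ← mul_assoc, ← Units.val_mul, ← _root_.zpow_add]
  | @relabel E F G G' h =>
    have := G.finite
    have := G'.finite
    have := Fintype.ofFinite E
    have := Fintype.ofFinite F
    refine ⟨0, ?_⟩
    rw [GaussDiagram.alexanderInvariant_eq, GaussDiagram.alexanderInvariant_eq,
      GaussDiagram.alexanderDet_relabeling s t h]
    simp
  | @subdivide E F G G' h =>
    have := G.finite
    have := G'.finite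
    have := Fintype.ofFinite E
    have := Fintype.ofFinite F
    refine ⟨0, ?_⟩
    rw [GaussDiagram.alexanderInvariant_eq, GaussDiagram.alexanderInvariant_eq,
      GaussDiagram.alexanderDet_subdivision s t h]
    simp
  | @reidemeister1 E G G' h =>
    have := G.finite
    have := Fintype.ofFinite E
    simp only [GaussDiagram.alexanderInvariant_eq]
    exact GaussDiagram.alexanderDet_reidemeister1 s t h
  | @reidemeister2 E G G' h =>
    have := G.finite
    have := Fintype.ofFinite E
    refine ⟨0, ?_⟩
    simp only [GaussDiagram.alexanderInvariant_eq]
    rw [GaussDiagram.alexanderDet_reidemeister2 s t h]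
    simp
  | @reidemeister3 E G G' h =>
    have := G.finite
    have := Fintype.ofFinite E
    refine ⟨0, ?_⟩
    simp only [GaussDiagram.alexanderInvariant_eq]
    rw [GaussDiagram.alexanderDet_reidemeister3 s t h]
    simp

end VirtualKnot
end

/-! ### Determinants of block cyclic matrices -/

noncomputable section
namespace VirtualKnot

open Matrix

section BlockCyclic

variable {k R : Type*} [Fintype k] [DecidableEq k] [CommRing R]

theorem det_comp_of_blockTriangular [Nonempty k] {I : Type*} [Fintype I] [DecidableEq I]
    (A : Matrix I I (Matrix k k R)) {b : I → ℕ} (hb : Function.Injective b)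
    (h : ∀ i j, b j < b i → A i j = 0) :
    (Matrix.comp I I k k R A).det = ∏ i, (A i i).det := by
  have ht : (Matrix.comp I I k k R A).BlockTriangular (fun x => b x.1) := by
    rintro ⟨i, x⟩ ⟨j, y⟩ hij
    simp [Matrix.comp_apply, h i j hij]
  rw [ht.det]
  have himg : Finset.univ.image (fun x : I × k => b x.1) = Finset.univ.image b := by
    ext a
    simp
  rw [himg, Finset.prod_image hb.injOn]
  refine Finset.prod_congr rfl fun i _ => ?_
  let e : k ≃ { a : I × k // b a.1 = b i } :=
    { toFun := fun x => ⟨(i, x), rfl⟩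
      invFun := fun a => a.1.2
      left_inv := fun x => rfl
      right_inv := by
        rintro ⟨⟨j, x⟩, hj⟩
        obtain rfl := hb hj
        rfl }
  rw [← Matrix.det_submatrix_equiv_self e]
  rfl

/-- The determinant of a block cyclic matrix. -/
theorem det_one_sub_blockCyclic [Nonempty k] (L : ℕ) (B : ℕ → Matrix k k R) :
    (1 - Matrix.comp _ _ k k R (Matrix.of fun l l' : Fin (L + 1) =>
      if l' = finRotate (L + 1) l then B l else 0)).det =
    (1 - ((List.range (L + 1)).map B).prod).det := by
  set C : Matrix (Fin (L + 1)) (Fin (L + 1)) (Matrix k k R) := Matrix.of fun l l' =>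
      if l' = finRotate (L + 1) l then B l else 0 with hC
  let p : ℕ → Matrix k k R := fun m => ((List.range m).map B).prod
  have hp : ∀ m, p (m + 1) = p m * B m := fun m => List.prod_range_succ B m
  have hp0 : p 0 = 1 := rfl
  -- Left multiplication by V replaces the first block row by a combination with the partial
  -- products as coefficients. The result telescopes: only the entry at level 0 survives, and it is
  -- 1 minus the full product.
  let V : Matrix (Fin (L + 1)) (Fin (L + 1)) (Matrix k k R) := Matrix.of fun l l' =>
    if l = 0 then p l' else if l = l' then 1 else 0
  have hV : (Matrix.comp _ _ k k R V).det = 1 := by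
    rw [det_comp_of_blockTriangular V Fin.val_injective]
    · refine Finset.prod_eq_one fun l _ => ?_
      by_cases hl : l = 0
      · subst hl
        simp [V, hp0]
      · simp [V, hl]
    · intro i j hij
      have h0 : i ≠ 0 := by
        rintro rfl
        simp at hij
      have h1 : i ≠ j := by
        rintro rfl
        simp at hij
      simp [V, h0, h1]
  have h0 : ∀ l : Fin (L + 1), (V * (1 - C)) 0 (finRotate (L + 1) l) =
      p (finRotate (L + 1) l) - p (l + 1) := by
    intro l
    rw [Matrix.mul_sub, Matrix.mul_one, Matrix.sub_apply, Matrix.mul_apply,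
      Finset.sum_eq_single l]
    · simp [V, C, hp]
    · intro l' _ hl'
      simp [C, hl'.symm]
    · simp
  have h1 : ∀ l m : Fin (L + 1), l ≠ 0 → (V * (1 - C)) l m =
      (if l = m then 1 else 0) - if m = finRotate (L + 1) l then B l else 0 := by
    intro l m hl
    rw [Matrix.mul_apply, Finset.sum_eq_single l]
    · simp [V, C, hl, Matrix.one_apply]
    · intro l' _ hl'
      simp [V, hl, hl'.symm]
    · simp
  -- Moving level 0 to the end makes V (1 - C) block upper triangular, since the successor of the
  -- last level is 0.
  let b : Fin (L + 1) → ℕ := fun l => if l = 0 then L + 1 else l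
  have hb : Function.Injective b := by
    intro i j hij
    have := i.2
    have := j.2
    simp only [b, Fin.ext_iff, Fin.val_zero] at hij ⊢
    split_ifs at hij <;> omega
  have h2 : (Matrix.comp _ _ k k R (V * (1 - C))).det = (1 - p (L + 1)).det := by
    rw [det_comp_of_blockTriangular (V * (1 - C)) hb]
    · rw [Finset.prod_eq_single 0]
      · have := h0 (Fin.last L)
        rw [finRotate_last] at this
        rw [this]
        simp [hp0]
      · intro l _ hl
        rw [h1 l l hl]
        by_cases hl' : l = finRotate (L + 1) l
        · exfalso
          by_cases hlast : l = Fin.last L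
          · subst hlast
            exact hl (hl'.trans finRotate_last)
          · have := congrArg Fin.val hl'
            rw [coe_finRotate_of_ne_last hlast] at this
            omega
        · rw [if_pos rfl, if_neg hl', sub_zero, Matrix.det_one]
      · simp
    · intro i j hij
      have hj : j ≠ 0 := by
        rintro rfl
        have := i.2
        simp only [b, if_true] at hij
        split_ifs at hij <;> omega
      by_cases hi : i = 0
      · subst hi
        obtain ⟨l, rfl⟩ := (finRotate (L + 1)).surjective j
        rw [h0]
        have hl : l ≠ Fin.last L := by
          rintro rfl
          exact hj finRotate_last
        rw [coe_finRotate_of_ne_last hl, sub_self]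
      · rw [h1 i j hi]
        simp only [b, hi, hj, if_false] at hij
        have hne : i ≠ j := by
          rintro rfl
          simp at hij
        have hne' : j ≠ finRotate (L + 1) i := by
          rintro rfl
          by_cases hl : i = Fin.last L
          · subst hl
            exact hj finRotate_last
          · rw [coe_finRotate_of_ne_last hl] at hij
            omega
        rw [if_neg hne, if_neg hne', sub_zero]
  have h3 : Matrix.comp _ _ k k R (V * (1 - C)) =
      Matrix.comp _ _ k k R V * (1 - Matrix.comp _ _ k k R C) := by
    have := (Matrix.compRingEquiv (Fin (L + 1)) k R).map_mul V (1 - C)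
    rw [map_sub, map_one] at this
    exact this
  rw [h3, Matrix.det_mul, hV, one_mul] at h2
  exact h2

end BlockCyclic

end VirtualKnot
end

/-! ### The virtual Burau matrices and the weights of chords -/

noncomputable section
namespace VirtualKnot

open Matrix

/-- The monomials as units. -/
def monomialHom : Multiplicative (ℤ × ℤ × ℤ) →* Laurentˣ :=
  (AddMonoidAlgebra.of ℤ (ℤ × ℤ × ℤ)).toHomUnits

theorem val_monomialHom (a b c : ℤ) :
    ((monomialHom (Multiplicative.ofAdd (a, b, c)) : Laurentˣ) : Laurent) = mono a b c := rfl

theorem mono_mul_mono (a b c a' b' c' : ℤ) :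
    mono a b c * mono a' b' c' = mono (a + a') (b + b') (c + c') := by
  simp [mono, AddMonoidAlgebra.single_mul_single]

theorem mono_zero : mono 0 0 0 = 1 := rfl

/-- The weight `s * q⁻¹`. -/
def overWeight : Laurentˣ := monomialHom (Multiplicative.ofAdd (1, 0, -1))

/-- The weight `t * q`. -/
def underWeight : Laurentˣ := monomialHom (Multiplicative.ofAdd (0, 1, 1))

theorem val_overWeight : (overWeight : Laurent) = mono 1 0 (-1) := rfl

theorem val_underWeight : (underWeight : Laurent) = mono 0 1 1 := rfl

theorem val_inv_overWeight : ((overWeight⁻¹ : Laurentˣ) : Laurent) = mono (-1) 0 1 := by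
  rw [overWeight, ← map_inv]
  rfl

theorem val_inv_underWeight : ((underWeight⁻¹ : Laurentˣ) : Laurent) = mono 0 (-1) (-1) := by
  rw [underWeight, ← map_inv]
  rfl

theorem val_overWeight_mul_underWeight_zpow (m : ℤ) :
    (((overWeight * underWeight) ^ m : Laurentˣ) : Laurent) = mono m m 0 := by
  rw [overWeight, underWeight, ← map_mul, ← map_zpow, ← ofAdd_add, ← ofAdd_zsmul]
  simp [val_monomialHom]

/-- The chord of a generator, on the positions of the strands. -/
def BraidLetter.chords {n : ℕ} : BraidLetter n → Set (Chord (Fin (n + 1)))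
  | .sigma i ε => {if ε = 1 then ⟨i.succ, i.castSucc, 1⟩ else ⟨i.castSucc, i.succ, -1⟩}
  | .tau _ => ∅

/-- Conjugation of a matrix by the powers of `q`. -/
def qConj (n : ℕ) : Matrix (Fin n) (Fin n) Laurent →* Matrix (Fin n) (Fin n) Laurent where
  toFun A := Matrix.diagonal (fun i : Fin n => mono 0 0 (-(i : ℤ))) * A *
    Matrix.diagonal (fun i : Fin n => mono 0 0 (i : ℤ))
  map_one' := by
    simp [mono_mul_mono, mono_zero]
  map_mul' A B := by
    have h : Matrix.diagonal (fun i : Fin n => mono 0 0 (i : ℤ)) *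
        Matrix.diagonal (fun i : Fin n => mono 0 0 (-(i : ℤ))) = 1 := by
      simp [mono_mul_mono, mono_zero]
    simp only [Matrix.mul_assoc]
    rw [← Matrix.mul_assoc (Matrix.diagonal (fun i : Fin n => mono 0 0 (i : ℤ))), h, Matrix.one_mul]

theorem qConj_apply {n : ℕ} (A : Matrix (Fin n) (Fin n) Laurent) (i j : Fin n) :
    qConj n A i j = mono 0 0 ((j : ℤ) - i) * A i j := by
  have : mono 0 0 ((j : ℤ) - i) = mono 0 0 (-(i : ℤ)) * mono 0 0 (j : ℤ) := by
    rw [mono_mul_mono]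
    congr 1
    ring
  rw [this]
  simp only [qConj, MonoidHom.coe_mk, OneHom.coe_mk, Matrix.mul_diagonal, Matrix.diagonal_mul]
  ring

theorem det_one_sub_qConj {n : ℕ} (A : Matrix (Fin n) (Fin n) Laurent) :
    (1 - qConj n A).det = (1 - A).det := by
  have h : Matrix.diagonal (fun i : Fin n => mono 0 0 (i : ℤ)) *
      Matrix.diagonal (fun i : Fin n => mono 0 0 (-(i : ℤ))) = 1 := by
    simp [mono_mul_mono, mono_zero]
  have h' : Matrix.diagonal (fun i : Fin n => mono 0 0 (-(i : ℤ))) *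
      Matrix.diagonal (fun i : Fin n => mono 0 0 (i : ℤ)) = 1 := mul_eq_one_comm.1 h
  have h1 : 1 - qConj n A = Matrix.diagonal (fun i : Fin n => mono 0 0 (-(i : ℤ))) * (1 - A) *
      Matrix.diagonal (fun i : Fin n => mono 0 0 (i : ℤ)) := by
    rw [Matrix.mul_sub, Matrix.sub_mul, Matrix.mul_one, h']
    rfl
  rw [h1, Matrix.det_mul_right_comm, h', Matrix.one_mul]

-- Conjugation by powers of q scales the entry (i, i+1) by q and (i+1, i) by q⁻¹. It makes the
-- matrix of a virtual crossing a permutation matrix and gives t and s the weights tq and s/q.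
-- Undoing the permutation of the letter turns the Burau matrix into the weight matrix of its chord.
set_option linter.unusedSimpArgs false in
theorem BraidLetter.qConj_burau_apply {n : ℕ} (g : BraidLetter n) (x y : Fin (n + 1)) :
    qConj (n + 1) g.burau x (g.perm y) =
      (1 : Matrix (Fin (n + 1)) (Fin (n + 1)) Laurent) x y +
        weightSum overWeight underWeight g.chords x y := by
  have hi : ∀ i : Fin n, i.castSucc ≠ i.succ := fun i => (Fin.castSucc_lt_succ).ne
  have hst : ((overWeight : Laurent) * underWeight) = mono 1 1 0 := by
    rw [val_overWeight, val_underWeight, mono_mul_mono]; rfl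
  have hst' : ((overWeight⁻¹ : Laurentˣ) : Laurent) * ((underWeight⁻¹ : Laurentˣ) : Laurent) =
      mono (-1) (-1) 0 := by
    rw [val_inv_overWeight, val_inv_underWeight, mono_mul_mono]; rfl
  rw [qConj_apply]
  rcases g with ⟨i, ε⟩ | i
  · have hne := hi i
    have hne' := (hi i).symm
    rcases Int.units_eq_one_or ε with rfl | rfl
    all_goals
      simp only [BraidLetter.perm, BraidLetter.chords, BraidLetter.burau, blockAt,
        GaussDiagram.weightSum_singleton, Chord.weight, Matrix.of_apply, Matrix.add_apply,
        Matrix.single_apply, Matrix.one_apply]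
      by_cases hx : x = i.castSucc
      · by_cases hy : y = i.castSucc
        · subst hx hy
          simp [hne, hne', mono_mul_mono, val_overWeight, val_underWeight, val_inv_overWeight,
            val_inv_underWeight, mul_sub, mono_zero]
        · by_cases hy' : y = i.succ
          · subst hx hy'
            simp [hne, hne', mono_mul_mono, val_overWeight, val_underWeight, val_inv_overWeight,
              val_inv_underWeight, mul_sub, mono_zero]
          · subst hx
            simp [Equiv.swap_apply_of_ne_of_ne hy hy', hne, hne', hy, hy', Ne.symm hy, Ne.symm hy']
      · by_cases hx' : x = i.succ
        · by_cases hy : y = i.castSucc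
          · subst hx' hy
            simp [hne, hne', mono_mul_mono, val_overWeight, val_underWeight, val_inv_overWeight,
              val_inv_underWeight, mul_sub, mono_zero]
          · by_cases hy' : y = i.succ
            · subst hx' hy'
              simp [hne, hne', mono_mul_mono, val_overWeight, val_underWeight, val_inv_overWeight,
                val_inv_underWeight, mul_sub, mono_zero]
            · subst hx'
              simp [Equiv.swap_apply_of_ne_of_ne hy hy', hne, hne', hy, hy', Ne.symm hy,
                Ne.symm hy']
        · have e : x = Equiv.swap i.castSucc i.succ y ↔ x = y := by
            rw [← Equiv.symm_apply_eq, Equiv.symm_swap, Equiv.swap_apply_of_ne_of_ne hx hx']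
          by_cases hxy : x = y
          · subst hxy
            simp [hx, hx', Equiv.swap_apply_of_ne_of_ne hx hx', mono_zero, Ne.symm hx, Ne.symm hx']
          · simp [hx, hx', e, hxy, Ne.symm hx, Ne.symm hx']
  · have hne := hi i
    have hne' := (hi i).symm
    simp only [BraidLetter.perm, BraidLetter.chords, BraidLetter.burau, blockAt,
      GaussDiagram.weightSum_empty, Matrix.of_apply, Matrix.zero_apply, Matrix.one_apply, add_zero]
    by_cases hx : x = i.castSucc
    · by_cases hy : y = i.castSucc
      · subst hx hy
        simp [hne, hne', mono_mul_mono, mono_zero]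
      · by_cases hy' : y = i.succ
        · subst hx hy'
          simp [hne, hne']
        · subst hx
          simp [Equiv.swap_apply_of_ne_of_ne hy hy', hne, hy, hy', Ne.symm hy]
    · by_cases hx' : x = i.succ
      · by_cases hy : y = i.castSucc
        · subst hx' hy
          simp [hne, hne']
        · by_cases hy' : y = i.succ
          · subst hx' hy'
            simp [hne, hne', mono_mul_mono, mono_zero]
          · subst hx'
            simp [Equiv.swap_apply_of_ne_of_ne hy hy', hne', hy, hy', Ne.symm hy']
      · have e : x = Equiv.swap i.castSucc i.succ y ↔ x = y := by
          rw [← Equiv.symm_apply_eq, Equiv.symm_swap, Equiv.swap_apply_of_ne_of_ne hx hx']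
        simp only [hx, hx', if_false, e]
        by_cases hxy : x = y
        · subst hxy
          simp [Equiv.swap_apply_of_ne_of_ne hx hx', mono_zero]
        · simp [hxy]

end VirtualKnot
end

/-! ### The Alexander determinant of a braid closure -/

noncomputable section
namespace VirtualKnot

open Matrix

namespace VirtualBraid

variable {n : ℕ}

/-- The chords of the letter at level `l`, on the positions of the strands. -/
def levelChords (β : VirtualBraid n) (l : ℕ) : Set (Chord (Fin (n + 1))) :=
  match β[l]? with
  | some g => g.chords
  | none => ∅

/-- The matrix of the letter at level `l`. -/
def levelMatrix (β : VirtualBraid n) (l : ℕ) : Matrix (Fin (n + 1)) (Fin (n + 1)) Laurent :=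
  match β[l]? with
  | some g => qConj (n + 1) g.burau
  | none => 1

theorem mem_closure_chords (β : VirtualBraid n) (c : Chord (Fin (β.length + 1) × Fin (n + 1))) :
    c ∈ β.closure.chords ↔ ∃ l : Fin (β.length + 1), ∃ d ∈ β.levelChords l,
      c = d.map (Prod.mk l) := by
  have h1 : ¬ ((-1 : ℤˣ) = 1) := by decide
  constructor
  · rintro ⟨l, i, ⟨h, rfl⟩ | ⟨h, rfl⟩⟩
    · exact ⟨l, ⟨i.succ, i.castSucc, 1⟩, by simp [levelChords, h, BraidLetter.chords], rfl⟩
    · exact ⟨l, ⟨i.castSucc, i.succ, -1⟩, by simp [levelChords, h, BraidLetter.chords, h1], rfl⟩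
  · rintro ⟨l, d, hd, rfl⟩
    unfold levelChords at hd
    rcases hβ : β[(l : ℕ)]? with _ | (⟨i, ε⟩ | i)
    · simp [hβ] at hd
    · rcases Int.units_eq_one_or ε with rfl | rfl
      · simp only [hβ, BraidLetter.chords, if_true, Set.mem_singleton_iff] at hd
        subst hd
        exact ⟨l, i, Or.inl ⟨hβ, rfl⟩⟩
      · simp only [hβ, BraidLetter.chords, h1, if_false, Set.mem_singleton_iff] at hd
        subst hd
        exact ⟨l, i, Or.inr ⟨hβ, rfl⟩⟩
    · simp [hβ, BraidLetter.chords] at hd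

theorem levelMatrix_apply (β : VirtualBraid n) (l : ℕ) (x y : Fin (n + 1)) :
    β.levelMatrix l x (β.permAt l y) =
      (1 : Matrix (Fin (n + 1)) (Fin (n + 1)) Laurent) x y +
        weightSum overWeight underWeight (β.levelChords l) x y := by
  unfold levelMatrix permAt levelChords
  rcases β[l]? with _ | g
  · change (1 : Matrix (Fin (n + 1)) (Fin (n + 1)) Laurent) x y = _ + weightSum _ _ ∅ x y
    rw [GaussDiagram.weightSum_empty]
    exact (add_zero _).symm
  · exact g.qConj_burau_apply x y

theorem weightSum_closure_apply (β : VirtualBraid n) (l l' : Fin (β.length + 1))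
    (i j : Fin (n + 1)) :
    weightSum overWeight underWeight β.closure.chords (l, i) (l', j) =
      if l = l' then weightSum overWeight underWeight (β.levelChords l) i j else 0 := by
  have hinj : Function.Injective (Prod.mk l : Fin (n + 1) → Fin (β.length + 1) × Fin (n + 1)) :=
    Prod.mk_right_injective l
  have hc : β.closure.chords = Chord.map (Prod.mk l) '' β.levelChords l ∪
      {c | ∃ l' : Fin (β.length + 1), l' ≠ l ∧ ∃ d ∈ β.levelChords l', c = d.map (Prod.mk l')} := by
    ext c
    rw [mem_closure_chords]
    constructor
    · rintro ⟨l', d, hd, rfl⟩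
      by_cases h : l' = l
      · subst h
        exact Or.inl ⟨d, hd, rfl⟩
      · exact Or.inr ⟨l', h, d, hd, rfl⟩
    · rintro (⟨d, hd, rfl⟩ | ⟨l', -, d, hd, rfl⟩)
      · exact ⟨l, d, hd, rfl⟩
      · exact ⟨l', d, hd, rfl⟩
  have hdis : Disjoint (Chord.map (Prod.mk l) '' β.levelChords l)
      {c | ∃ l' : Fin (β.length + 1), l' ≠ l ∧ ∃ d ∈ β.levelChords l', c = d.map (Prod.mk l')} := by
    rw [Set.disjoint_left]
    rintro _ ⟨d, hd, rfl⟩ ⟨l', hl', d', hd', h⟩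
    have := congrArg (fun c => c.overEnd.1) h
    exact hl' this.symm
  rw [hc, weightSum_union _ _ hdis, Matrix.add_apply]
  rw [weightSum_apply_eq_zero_left _ _ {c | ∃ l' : Fin (β.length + 1), l' ≠ l ∧
    ∃ d ∈ β.levelChords l', c = d.map (Prod.mk l')}, add_zero]
  · by_cases h : l = l'
    · subst h
      rw [if_pos rfl]
      exact GaussDiagram.weightSum_image_map_apply _ _ hinj _ i j
    · rw [if_neg h]
      apply weightSum_apply_eq_zero_right
      rintro _ ⟨d, -, rfl⟩
      exact ⟨fun h' => h (congrArg Prod.fst h'), fun h' => h (congrArg Prod.fst h')⟩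
  · rintro _ ⟨l', hl', d, -, rfl⟩
    exact ⟨fun h' => hl' (congrArg Prod.fst h'), fun h' => hl' (congrArg Prod.fst h')⟩

/-- Permuting the columns by `next` re-indexes each unknown by the end of its arc. The successor
part becomes the identity, and the rest sends each level to the next one by the matrix of its
letter. -/
theorem alexanderMatrix_closure_mul (β : VirtualBraid n) :
    β.closure.alexanderMatrix overWeight underWeight * β.closure.next.permMatrix Laurent =
      Matrix.comp _ _ _ _ Laurent (Matrix.of fun l l' : Fin (β.length + 1) =>
        if l' = finRotate (β.length + 1) l then β.levelMatrix l else 0) - 1 := by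
  ext ⟨l, i⟩ y
  obtain ⟨⟨l', j⟩, rfl⟩ := β.closure.next.surjective y
  rw [Matrix.mul_apply, Finset.sum_eq_single (l', j)]
  · rw [GaussDiagram.alexanderMatrix_apply, weightSum_closure_apply, Matrix.sub_apply]
    have h1 : β.closure.next.permMatrix Laurent (l', j) (β.closure.next (l', j)) = 1 := by
      simp [PEquiv.toMatrix_apply]
    rw [h1, mul_one, Matrix.one_apply (i := (l, i)) (j := β.closure.next (l', j))]
    congr 1
    have hn : β.closure.next (l', j) = (finRotate (β.length + 1) l', β.permAt l' j) := rfl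
    rw [hn, Matrix.comp_apply, Matrix.of_apply]
    by_cases h : l = l'
    · subst h
      rw [if_pos rfl, if_pos rfl, levelMatrix_apply]
      simp [Matrix.one_apply]
    · have h' : ¬ (finRotate (β.length + 1) l' = finRotate (β.length + 1) l) :=
        fun h' => h ((finRotate (β.length + 1)).injective h').symm
      rw [if_neg h, if_neg h']
      simp [h]
  · intro z _ hz
    have : β.closure.next.permMatrix Laurent z (β.closure.next (l', j)) = 0 := by
      simp only [PEquiv.toMatrix_apply, Equiv.toPEquiv_apply, Option.mem_def, Option.some.injEq,
        β.closure.next.injective.eq_iff, hz, if_false]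
    rw [this, mul_zero]
  · simp

theorem prod_levelMatrix (β : VirtualBraid n) :
    ((List.range (β.length + 1)).map β.levelMatrix).prod = qConj (n + 1) β.burau := by
  have h : (List.range β.length).map β.levelMatrix =
      β.map fun g => qConj (n + 1) g.burau := by
    apply List.ext_getElem
    · simp
    · intro i h1 h2
      have : i < β.length := by simpa using h1
      simp [levelMatrix, List.getElem?_eq_getElem this]
  have h' : β.levelMatrix β.length = 1 := by simp [levelMatrix]
  rw [List.prod_range_succ, h', mul_one, h, burau, map_list_prod, List.map_map]
  rfl

/-- Each letter contributes ±1 to writhe + v, so the parity is that of the length. -/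
theorem neg_one_zpow_writhe_add_virtualCrossings (β : VirtualBraid n) :
    (-1 : ℤˣ) ^ (β.writhe + β.virtualCrossings) = (-1) ^ β.length := by
  induction β with
  | nil => simp [writhe, virtualCrossings]
  | cons g β ih =>
    have h : VirtualBraid.writhe (g :: β) + VirtualBraid.virtualCrossings (g :: β) =
        (match g with
          | .sigma _ ε => (ε : ℤ)
          | .tau _ => 1) +
          (VirtualBraid.writhe β + VirtualBraid.virtualCrossings β) := by
      rcases g with ⟨i, ε⟩ | i <;> simp [writhe, virtualCrossings] <;> ring
    rw [h, _root_.zpow_add, ih, List.length_cons, pow_succ']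
    congr 1
    rcases g with ⟨i, ε⟩ | i
    · rcases Int.units_eq_one_or ε with rfl | rfl <;> simp
    · simp

/-- The first factor comes from the n + 1 rotations of the levels, cycles of length `β.length + 1`.
The second comes from the letters, each of which is a transposition. -/
theorem sign_closure_next (β : VirtualBraid n) :
    Equiv.Perm.sign β.closure.next = (-1) ^ (β.length * (n + 1)) * (-1) ^ β.length := by
  have h : β.closure.next = Equiv.prodCongrLeft (fun _ : Fin (n + 1) => finRotate (β.length + 1)) *
      Equiv.prodCongrRight (fun l : Fin (β.length + 1) => β.permAt l) := rfl
  rw [h, map_mul, Equiv.Perm.sign_prodCongrLeft, Equiv.Perm.sign_prodCongrRight]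
  congr 1
  · simp [sign_finRotate, pow_mul]
  · rw [Fin.prod_univ_castSucc]
    have h1 : β.permAt (Fin.last β.length : Fin (β.length + 1)) = 1 := by simp [permAt]
    have h2 : ∀ l : Fin β.length, Equiv.Perm.sign (β.permAt (l.castSucc : Fin (β.length + 1))) =
        -1 := by
      intro l
      simp only [permAt, Fin.val_castSucc, List.getElem?_eq_getElem l.2]
      rcases β[(l : ℕ)] with ⟨i, ε⟩ | i <;>
        exact Equiv.Perm.sign_swap (Fin.castSucc_lt_succ).ne
    rw [h1, Finset.prod_congr rfl fun l _ => h2 l]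
    simp

theorem alexanderDet_closure (β : VirtualBraid n) :
    β.closure.alexanderDet overWeight underWeight = β.normalizedDet := by
  have h := congrArg Matrix.det (alexanderMatrix_closure_mul β)
  rw [Matrix.det_mul, Matrix.det_permutation, sign_closure_next, ← neg_sub, Matrix.det_neg,
    det_one_sub_blockCyclic, prod_levelMatrix, det_one_sub_qConj, ← neg_sub β.burau 1,
    Matrix.det_neg] at h
  rw [normalizedDet, neg_one_zpow_writhe_add_virtualCrossings]
  simp only [Fintype.card_prod, Fintype.card_fin] at h
  change β.closure.alexanderDet overWeight underWeight * _ = _ at h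
  push_cast at h ⊢
  rw [zsmul_eq_mul]
  push_cast
  set H := β.closure.alexanderDet overWeight underWeight
  have e : ∀ k : ℕ, ((-1 : Laurent) ^ k) * (-1) ^ k = 1 := fun k => by
    rw [← mul_pow]; simp
  have e' : ((-1 : Laurent)) ^ ((β.length + 1) * (n + 1)) =
      (-1) ^ (β.length * (n + 1)) * (-1) ^ (n + 1) := by
    rw [← pow_add]; congr 1; ring
  rw [e'] at h
  calc H = H * ((-1) ^ (β.length * (n + 1)) * (-1) ^ β.length) *
        ((-1) ^ (β.length * (n + 1)) * (-1) ^ β.length) := by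
        linear_combination (-H * ((-1) ^ β.length * (-1) ^ β.length)) * e (β.length * (n + 1)) -
          H * e β.length
    _ = _ := by
        rw [h]
        linear_combination ((-1) ^ β.length * (β.burau - 1).det * ((-1) ^ (n + 1) * (-1) ^ (n + 1)))
          * e (β.length * (n + 1)) + (-1) ^ β.length * (β.burau - 1).det * e (n + 1)

end VirtualBraid
end VirtualKnot
end

/-! ### Reduction modulo p and block circulants -/

noncomputable section
namespace VirtualKnot

open Matrix

section Reduction

/-- Reduction of the coefficients of a Laurent polynomial modulo `p`. -/
def reduction (p : ℕ) : Laurent →+* AddMonoidAlgebra (ZMod p) (ℤ × ℤ × ℤ) :=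
  AddMonoidAlgebra.mapRingHom _ (Int.castRingHom (ZMod p))

theorem dvd_of_reduction_eq_zero {p : ℕ} {x : Laurent} (h : reduction p x = 0) :
    (p : Laurent) ∣ x := by
  have hx : ∀ m, (p : ℤ) ∣ x.coeff m := by
    intro m
    have h1 : (reduction p x).coeff m = 0 := by rw [h]; rfl
    rw [reduction, AddMonoidAlgebra.coeff_mapRingHom] at h1
    exact (ZMod.intCast_zmod_eq_zero_iff_dvd _ _).1 h1
  refine ⟨AddMonoidAlgebra.ofCoeff (x.coeff.mapRange (fun z => z / (p : ℤ)) (by simp)), ?_⟩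
  rw [← nsmul_eq_mul]
  ext m
  rw [AddMonoidAlgebra.coeff_smul, Finsupp.smul_apply, Finsupp.mapRange_apply, nsmul_eq_mul,
    Int.mul_ediv_cancel' (hx m)]

instance charP_addMonoidAlgebra_zmod (p : ℕ) :
    CharP (AddMonoidAlgebra (ZMod p) (ℤ × ℤ × ℤ)) p := by
  refine charP_of_injective_algebraMap (R := ZMod p) ?_ p
  intro a b h
  have := congrArg (fun x => AddMonoidAlgebra.coeff x 0) h
  simpa [AddMonoidAlgebra.algebraMap_def] using this

theorem Chord.weight_map_ringHom {E : Type} {R S : Type*} [DecidableEq E] [CommRing R] [CommRing S]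
    (φ : R →+* S) (s t : Rˣ) (c : Chord E) :
    (c.weight s t).map φ = c.weight (Units.map (φ : R →* S) s) (Units.map (φ : R →* S) t) := by
  have h : ∀ A B : Matrix E E R, (A + B).map φ = A.map φ + B.map φ := fun A B =>
    Matrix.map_add φ (map_add φ) A B
  simp only [Chord.weight, h, Matrix.map_single, map_sub, map_one, ← map_zpow, ← map_mul]
  rfl

theorem GaussDiagram.alexanderDet_map {E : Type} [Fintype E] [DecidableEq E] {R S : Type*}
    [CommRing R] [CommRing S] (φ : R →+* S) (s t : Rˣ) (G : GaussDiagram E) :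
    φ (G.alexanderDet s t) =
      G.alexanderDet (Units.map (φ : R →* S) s) (Units.map (φ : R →* S) t) := by
  rw [alexanderDet, alexanderDet, RingHom.map_det]
  congr 1
  have h : (weightSum s t G.chords).map φ =
      weightSum (Units.map (φ : R →* S) s) (Units.map (φ : R →* S) t) G.chords := by
    let ψ : Matrix E E R →+ Matrix E E S :=
      { toFun := fun A => A.map φ
        map_zero' := by ext; simp
        map_add' := Matrix.map_add φ (map_add φ) }
    have := ψ.map_finsum_mem (fun c => Chord.weight s t c) G.chords.toFinite
    refine this.trans (finsum_mem_congr rfl fun c _ => ?_)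
    exact c.weight_map_ringHom φ s t
  ext x y
  have hxy := congrFun (congrFun h x) y
  rw [RingHom.mapMatrix_apply, Matrix.map_apply, alexanderMatrix_apply, alexanderMatrix_apply,
    ← hxy, map_sub, map_add, Matrix.map_apply]
  simp only [Matrix.one_apply, apply_ite φ, map_one, map_zero]

end Reduction

section Circulant

variable {R : Type*} [CommRing R]

/-- The matrix of the generator of a cyclic group. -/
def cyclicShift (R : Type*) [CommRing R] (N : ℕ) : Matrix (ZMod N) (ZMod N) R :=
  Matrix.of fun j k => if j + 1 = k then 1 else 0

theorem cyclicShift_apply (N : ℕ) (j k : ZMod N) :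
    cyclicShift R N j k = if j + 1 = k then 1 else 0 := rfl

theorem cyclicShift_pow_apply (N : ℕ) [NeZero N] (i : ℕ) (j k : ZMod N) :
    (cyclicShift R N ^ i) j k = if j + i = k then 1 else 0 := by
  induction i generalizing k with
  | zero => simp [Matrix.one_apply]
  | succ i ih =>
    rw [pow_succ, Matrix.mul_apply, Finset.sum_eq_single (j + i)]
    · simp [ih, cyclicShift_apply, add_assoc]
    · intro l _ hl
      simp [ih, hl.symm]
    · simp

theorem cyclicShift_pow_self (N : ℕ) [NeZero N] : cyclicShift R N ^ N = 1 := by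
  ext j k
  simp [cyclicShift_pow_apply, Matrix.one_apply]

-- Write T for the shift and n for p^r. As a - a(1) is divisible by X - 1 and n-th powers are
-- additive in characteristic p, a^n - a(1)^n is divisible by X^n - 1, which vanishes at T.
open Polynomial in
theorem det_aeval_cyclicShift [IsDomain R] (p : ℕ) [Fact p.Prime] [CharP R p] (r : ℕ) (a : R[X]) :
    (aeval (cyclicShift R (p ^ r)) a).det = (a.eval 1) ^ p ^ r := by
  have : NeZero (p ^ r) := ⟨pow_ne_zero r (Fact.out : p.Prime).ne_zero⟩
  obtain ⟨b, hb⟩ : X - C (1 : R) ∣ a - C (a.eval 1) := X_sub_C_dvd_sub_C_eval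
  have h1 : a ^ p ^ r = C (a.eval 1 ^ p ^ r) + (X ^ p ^ r - 1) * b ^ p ^ r := by
    have h := congrArg (fun f : R[X] => f ^ p ^ r) hb
    simp only [sub_pow_char_pow, mul_pow] at h
    rw [C_1, one_pow, ← C_pow] at h
    rw [← h]
    ring
  have h2 : aeval (cyclicShift R (p ^ r)) a ^ p ^ r =
      algebraMap R _ (a.eval 1 ^ p ^ r) := by
    rw [← map_pow, h1, map_add, map_mul, map_sub, map_pow (aeval _) X, aeval_X, cyclicShift_pow_self,
      map_one, sub_self, zero_mul, add_zero, aeval_C]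
  have h3 := congrArg Matrix.det h2
  rw [Matrix.det_pow, Matrix.algebraMap_eq_diagonal, Matrix.det_diagonal] at h3
  simp only [Pi.algebraMap_apply, Algebra.algebraMap_self, RingHom.id_apply, Finset.prod_const,
    Finset.card_univ, ZMod.card] at h3
  -- The determinant and a(1)^n have equal n-th powers; additivity of the n-th power and the absence
  -- of nilpotents make them equal.
  have h4 : ((aeval (cyclicShift R (p ^ r)) a).det - a.eval 1 ^ p ^ r) ^ p ^ r = 0 := by
    rw [sub_pow_char_pow, h3, sub_self]
  exact sub_eq_zero.1 (pow_eq_zero_iff (NeZero.ne _) |>.1 h4)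

open Polynomial in
/-- The determinant of a block circulant matrix with `p ^ r` blocks in characteristic `p`. -/
theorem det_blockCirculant [IsDomain R] (p : ℕ) [Fact p.Prime] [CharP R p] (r : ℕ)
    [NeZero (p ^ r)] {I : Type*} [Fintype I] [DecidableEq I] (g : I → I → ZMod (p ^ r) → R) :
    (Matrix.of fun a b : I × ZMod (p ^ r) => g a.1 b.1 (b.2 - a.2)).det =
      (Matrix.of fun x y => ∑ i, g x y i).det ^ p ^ r := by
  let A : Matrix I I R[X] := Matrix.of fun x y => ∑ i, C (g x y i) * X ^ i.val
  let f : R[X] →+* Matrix (ZMod (p ^ r)) (ZMod (p ^ r)) R :=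
    (aeval (cyclicShift R (p ^ r))).toRingHom
  have h1 : Matrix.comp _ _ _ _ R (A.map f) =
      Matrix.of fun a b : I × ZMod (p ^ r) => g a.1 b.1 (b.2 - a.2) := by
    ext ⟨x, j⟩ ⟨y, k⟩
    have : f (A x y) j k = g x y (k - j) := by
      simp only [A, f, Matrix.of_apply, AlgHom.toRingHom_eq_coe, RingHom.coe_coe, map_sum, map_mul,
        aeval_C, map_pow, aeval_X, Matrix.sum_apply, ← Algebra.smul_def, Matrix.smul_apply]
      rw [Finset.sum_eq_single (k - j)]
      · simp [cyclicShift_pow_apply]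
      · intro i _ hi
        have : ¬ (j + i = k) := fun h => hi (by rw [← h]; ring)
        simp [cyclicShift_pow_apply, this]
      · simp
    exact this
  -- The blocks are polynomials in one shift matrix and commute, so the determinant is that of `f`
  -- applied to det A; evaluation at 1 sums the coefficients of each entry.
  rw [← h1, ← Matrix.det_det]
  have h2 : (Matrix.of fun x y => ∑ i, g x y i) = A.map (evalRingHom 1) := by
    ext x y
    simp [A, eval_finsetSum]
  rw [h2, ← RingHom.mapMatrix_apply, ← RingHom.map_det]
  exact det_aeval_cyclicShift p r A.det

end Circulant

end VirtualKnot
end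

/-! ### Periodic diagrams -/

noncomputable section
namespace VirtualKnot

open Matrix

namespace GaussDiagram

variable {E : Type} {G : GaussDiagram E} {N : ℕ}

theorem IsPeriodic.card_ne_zero (h : G.IsPeriodic N) : Nat.card E ≠ 0 := by
  have := G.finite
  have := h.isKnot.1
  exact Nat.card_ne_zero.2 ⟨inferInstance, inferInstance⟩

theorem IsPeriodic.ne_zero (h : G.IsPeriodic N) : N ≠ 0 := by
  rintro rfl
  exact h.card_ne_zero (Nat.eq_zero_of_zero_dvd h.dvd_card)

/-- On a single circle with N m points, powers of `next` agree at a point exactly when their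
exponents agree modulo N m. The rotation is the m-th power, so cancelling m shows that it acts
freely with order N. -/
theorem IsPeriodic.rotation_pow_apply_eq_iff (h : G.IsPeriodic N) (z : E) (i j : ℕ) :
    (G.rotation N ^ i) z = (G.rotation N ^ j) z ↔ i ≡ j [MOD N] := by
  have := G.finite
  have := Fintype.ofFinite E
  have hc : G.next.IsCycleOn ((Finset.univ : Finset E) : Set E) := by
    rw [Finset.coe_univ]
    exact ⟨Set.bijOn_univ.2 G.next.bijective, fun x _ y _ => h.isKnot.2 x y⟩
  obtain ⟨m, hm⟩ := h.dvd_card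
  have hN : 0 < N := Nat.pos_of_ne_zero h.ne_zero
  have hm0 : m ≠ 0 := by
    rintro rfl
    exact h.card_ne_zero hm
  have hd : Nat.card E / N = m := by rw [hm, Nat.mul_div_cancel_left _ hN]
  rw [rotation, hd, ← pow_mul, ← pow_mul, hc.pow_apply_eq_pow_apply (Finset.mem_univ z),
    Finset.card_univ, ← Nat.card_eq_fintype_card, hm, mul_comm N m]
  exact Nat.ModEq.mul_left_cancel_iff' hm0

theorem IsPeriodic.exists_rotation_pow_eq [NeZero N] (h : G.IsPeriodic N) {x y : E}
    (hxy : G.toQuotient N x = G.toQuotient N y) :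
    ∃ j : ZMod N, (G.rotation N ^ j.val) x = y := by
  obtain ⟨j, hj⟩ := IsPeriodic.exists_pow ((G.toQuotient_eq_iff N _ _).1 hxy)
  refine ⟨j, ?_⟩
  rw [← hj, h.rotation_pow_apply_eq_iff, ZMod.val_natCast]
  exact Nat.mod_modEq j N

theorem toQuotient_rotation_pow (G : GaussDiagram E) (N j : ℕ) (x : E) :
    G.toQuotient N ((G.rotation N ^ j) x) = G.toQuotient N x := by
  rw [toQuotient_eq_iff]
  exact ⟨-j, by simp⟩

theorem IsPeriodic.sum_ite_eq_rotation [NeZero N] (h : G.IsPeriodic N) [DecidableEq E]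
    [DecidableEq (G.QuotientPoint N)] {R : Type*} [CommRing R] (u z : E) (a : R) :
    ∑ i : ZMod N, (if u = (G.rotation N ^ i.val) z then a else 0) =
      if G.toQuotient N u = G.toQuotient N z then a else 0 := by
  by_cases hu : G.toQuotient N z = G.toQuotient N u
  · obtain ⟨j, rfl⟩ := h.exists_rotation_pow_eq hu
    rw [Finset.sum_eq_single j, if_pos rfl, if_pos hu.symm]
    · intro i _ hi
      rw [if_neg]
      intro hij
      have := (h.rotation_pow_apply_eq_iff z _ _).1 hij
      rw [← ZMod.natCast_eq_natCast_iff, ZMod.natCast_zmod_val, ZMod.natCast_zmod_val] at this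
      exact hi this.symm
    · simp
  · rw [if_neg (fun h => hu h.symm)]
    refine Finset.sum_eq_zero fun i _ => if_neg ?_
    rintro rfl
    exact hu (toQuotient_rotation_pow G N _ z).symm

/-- The base circle as a family of copies of its quotient. -/
def IsPeriodic.equivProd [NeZero N] (h : G.IsPeriodic N) : G.QuotientPoint N × ZMod N ≃ E :=
  Equiv.ofBijective (fun a => (G.rotation N ^ a.2.val) a.1.out) <| by
    have ho : ∀ x : G.QuotientPoint N, G.toQuotient N x.out = x := fun x => Quotient.out_eq x
    constructor
    · rintro ⟨x, i⟩ ⟨y, j⟩ hij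
      have hxy := congrArg (G.toQuotient N) hij
      simp only [toQuotient_rotation_pow, ho] at hxy
      subst hxy
      have := (h.rotation_pow_apply_eq_iff _ _ _).1 hij
      rw [← ZMod.natCast_eq_natCast_iff, ZMod.natCast_zmod_val, ZMod.natCast_zmod_val] at this
      exact congrArg _ this
    · intro z
      obtain ⟨j, hj⟩ := h.exists_rotation_pow_eq (ho (G.toQuotient N z))
      exact ⟨(G.toQuotient N z, j), hj⟩

theorem IsPeriodic.image_map_rotation (h : G.IsPeriodic N) :
    Chord.map (G.rotation N) '' G.chords = G.chords := by
  have := G.finite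
  refine Set.eq_of_subset_of_ncard_le ?_ ?_ (Set.toFinite _)
  · rintro _ ⟨c, hc, rfl⟩
    exact h.map_mem c hc
  · rw [Set.ncard_image_of_injective _ (Chord.map_injective (G.rotation N).injective)]

theorem weight_apply [DecidableEq E] {R : Type*} [CommRing R] (s t : Rˣ) (c : Chord E) (x y : E) :
    c.weight s t x y =
      (if c.overEnd = x then if y = c.overEnd then ((s ^ (c.sign : ℤ) : Rˣ) : R) - 1 else 0
        else 0) +
      (if c.underEnd = x then if y = c.underEnd then ((t ^ (c.sign : ℤ) : Rˣ) : R) - 1 else 0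
        else 0) +
      (if c.underEnd = x then if y = c.overEnd then 1 - (((s * t) ^ (c.sign : ℤ) : Rˣ) : R) else 0
        else 0) := by
  simp only [Chord.weight, Matrix.add_apply, Matrix.single_apply, ite_and, eq_comm (a := y)]

section

variable [Fintype E] [DecidableEq E] {R : Type*} [CommRing R]

theorem weightSum_apply_eq_of_end (s t : Rˣ) (G : GaussDiagram E) {c : Chord E} (hc : c ∈ G.chords)
    {x : E} (hx : c.overEnd = x ∨ c.underEnd = x) (y : E) :
    weightSum s t G.chords x y = c.weight s t x y := by
  rw [weightSum_apply, ← Set.insert_sdiff_self_of_mem hc,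
    finsum_mem_insert _ (by simp) (Set.toFinite _), finsum_mem_eq_zero_of_forall_eq_zero, add_zero]
  rintro d ⟨hd, hdc⟩
  have := G.ends_ne hd hc hdc
  rcases hx with rfl | rfl
  · exact d.weight_apply_eq_zero_left s t _ y this.1.1 this.2.1
  · exact d.weight_apply_eq_zero_left s t _ y this.1.2 this.2.2

theorem IsPeriodic.alexanderMatrix_rotation (h : G.IsPeriodic N) (s t : Rˣ) (x y : E) (j : ℕ) :
    G.alexanderMatrix s t ((G.rotation N ^ j) x) ((G.rotation N ^ j) y) =
      G.alexanderMatrix s t x y := by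
  induction j with
  | zero => rfl
  | succ j ih =>
    rw [← ih, pow_succ', Equiv.Perm.mul_apply, Equiv.Perm.mul_apply]
    generalize (G.rotation N ^ j) x = x
    generalize (G.rotation N ^ j) y = y
    have h1 : weightSum s t G.chords (G.rotation N x) (G.rotation N y) =
        weightSum s t G.chords x y := by
      conv_lhs => rw [← h.image_map_rotation]
      exact weightSum_image_map_apply s t (G.rotation N).injective _ x y
    have h2 : G.next (G.rotation N y) = G.rotation N (G.next y) := by
      have := (G.commute_next N).eq
      exact (DFunLike.congr_fun this y).symm
    rw [alexanderMatrix_apply, alexanderMatrix_apply, h1, h2]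
    simp only [Matrix.one_apply, (G.rotation N).injective.eq_iff]

/-- Every nonzero contribution to the row of u sits at a definite point, and exactly one rotation of
z reaches this point if its class is that of z. Summing over the orbit therefore gives the entry of
the quotient, even if several contributions fall on one class. -/
theorem IsPeriodic.sum_alexanderMatrix_rotation [NeZero N] (h : G.IsPeriodic N)
    [Fintype (G.QuotientPoint N)] [DecidableEq (G.QuotientPoint N)] (s t : Rˣ) (u z : E) :
    ∑ i : ZMod N, G.alexanderMatrix s t u ((G.rotation N ^ i.val) z) =
      (G.quotient N h).alexanderMatrix s t (G.toQuotient N u) (G.toQuotient N z) := by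
  have hn : ∀ i : ℕ, G.next ((G.rotation N ^ i) z) = (G.rotation N ^ i) (G.next z) := by
    intro i
    have := ((G.commute_next N).pow_left i).eq
    exact (DFunLike.congr_fun this z).symm
  have hn' : (G.quotient N h).next (G.toQuotient N z) = G.toQuotient N (G.next z) := rfl
  simp only [alexanderMatrix_apply, Matrix.one_apply, hn, hn', Finset.sum_sub_distrib,
    Finset.sum_add_distrib, h.sum_ite_eq_rotation]
  congr 2
  by_cases hu : ∃ c ∈ G.chords, c.overEnd = u ∨ c.underEnd = u
  · obtain ⟨c, hc, hcu⟩ := hu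
    have hc' : c.map (G.toQuotient N) ∈ (G.quotient N h).chords := ⟨c, hc, rfl⟩
    have hne := (G.quotient N h).over_ne_under _ hc' _ hc'
    have hcu' : (c.map (G.toQuotient N)).overEnd = G.toQuotient N u ∨
        (c.map (G.toQuotient N)).underEnd = G.toQuotient N u :=
      hcu.imp (congrArg (G.toQuotient N)) (congrArg (G.toQuotient N))
    rw [weightSum_apply_eq_of_end s t _ hc' hcu']
    simp only [weightSum_apply_eq_of_end s t G hc hcu, weight_apply, Finset.sum_add_distrib]
    have hsum : ∀ (P : Prop) [Decidable P] (v : E) (a : R),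
        ∑ i : ZMod N, (if P then if (G.rotation N ^ i.val) z = v then a else 0 else 0) =
        if P then if G.toQuotient N z = G.toQuotient N v then a else 0 else 0 := by
      intro P _ v a
      by_cases hP : P
      · simp only [hP, if_true, eq_comm (b := v), eq_comm (b := G.toQuotient N v)]
        exact h.sum_ite_eq_rotation v z a
      · simp [hP]
    rw [hsum, hsum, hsum]
    -- The ends of a chord remain distinct in the quotient, so the class of u tells which end of `c`
    -- it is.
    have e1 : (c.overEnd = u) ↔ (c.map (G.toQuotient N)).overEnd = G.toQuotient N u := by
      refine ⟨congrArg _, fun h' => hcu.resolve_right ?_⟩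
      rintro rfl
      exact hne h'
    have e2 : (c.underEnd = u) ↔ (c.map (G.toQuotient N)).underEnd = G.toQuotient N u := by
      refine ⟨congrArg _, fun h' => hcu.resolve_left ?_⟩
      rintro rfl
      exact hne h'.symm
    simp only [e1, e2]
    rfl
  · push Not at hu
    rw [weightSum_apply_eq_zero_left s t (G.quotient N h).chords]
    · exact Finset.sum_eq_zero fun i _ => weightSum_apply_eq_zero_left s t _ _ _ hu
    · rintro _ ⟨c, hc, rfl⟩
      constructor
      · intro hcu
        obtain ⟨j, hj⟩ := IsPeriodic.exists_pow ((G.toQuotient_eq_iff N _ _).1 hcu)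
        exact (hu _ (h.map_pow_mem j c hc)).1 hj
      · intro hcu
        obtain ⟨j, hj⟩ := IsPeriodic.exists_pow ((G.toQuotient_eq_iff N _ _).1 hcu)
        exact (hu _ (h.map_pow_mem j c hc)).2 hj

/-- In characteristic `p`, the Alexander determinant of a diagram of period `p ^ r` is a power of
that of its quotient. -/
theorem IsPeriodic.alexanderDet_eq_pow [IsDomain R] {p : ℕ} [Fact p.Prime] [CharP R p] {r : ℕ}
    (h : G.IsPeriodic (p ^ r)) [Fintype (G.QuotientPoint (p ^ r))]
    [DecidableEq (G.QuotientPoint (p ^ r))] (s t : Rˣ) :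
    G.alexanderDet s t = (G.quotient (p ^ r) h).alexanderDet s t ^ p ^ r := by
  have : NeZero (p ^ r) := ⟨h.ne_zero⟩
  rw [alexanderDet, ← Matrix.det_submatrix_equiv_self h.equivProd]
  obtain ⟨g, hg⟩ : ∃ g : G.QuotientPoint (p ^ r) → G.QuotientPoint (p ^ r) → ZMod (p ^ r) → R,
      ∀ x y i, g x y i =
        G.alexanderMatrix s t x.out ((G.rotation (p ^ r) ^ i.val) y.out) := ⟨_, fun _ _ _ => rfl⟩
  have h1 : (G.alexanderMatrix s t).submatrix h.equivProd h.equivProd =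
      Matrix.of fun a b : G.QuotientPoint (p ^ r) × ZMod (p ^ r) => g a.1 b.1 (b.2 - a.2) := by
    ext ⟨x, i⟩ ⟨y, j⟩
    rw [Matrix.submatrix_apply, Matrix.of_apply, hg]
    change G.alexanderMatrix s t ((G.rotation (p ^ r) ^ i.val) x.out)
      ((G.rotation (p ^ r) ^ j.val) y.out) = _
    refine Eq.trans ?_ (h.alexanderMatrix_rotation s t _ _ i.val)
    rw [← Equiv.Perm.mul_apply _ _ y.out, ← pow_add]
    congr 1
    rw [h.rotation_pow_apply_eq_iff, ← ZMod.natCast_eq_natCast_iff]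
    simp
  rw [h1, det_blockCirculant p r]
  congr 2
  ext x y
  simp only [Matrix.of_apply, hg]
  rw [h.sum_alexanderMatrix_rotation]
  have ho : ∀ x : G.QuotientPoint (p ^ r), G.toQuotient (p ^ r) x.out = x :=
    fun x => Quotient.out_eq x
  rw [ho, ho]

end

end GaussDiagram
end VirtualKnot
end

/-! ### Subdivision and first return maps -/

noncomputable section
namespace VirtualKnot

namespace GaussDiagram

open Classical in
/-- The diagram with one more subdivision point, placed after `e₀`. -/
def addPoint {E : Type} (G : GaussDiagram E) (e₀ : E) : GaussDiagram (Option E) where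
  finite := by
    have := G.finite
    infer_instance
  next := Equiv.swap none (some (G.next e₀)) * Equiv.optionCongr G.next
  chords := Chord.map some '' G.chords
  over_ne_under := by
    rintro _ ⟨c, hc, rfl⟩ _ ⟨d, hd, rfl⟩ h
    exact G.over_ne_under c hc d hd (Option.some_injective _ h)
  over_inj := by
    rintro _ ⟨c, hc, rfl⟩ _ ⟨d, hd, rfl⟩ h
    rw [G.over_inj c hc d hd (Option.some_injective _ h)]
  under_inj := by
    rintro _ ⟨c, hc, rfl⟩ _ ⟨d, hd, rfl⟩ h
    rw [G.under_inj c hc d hd (Option.some_injective _ h)]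

variable {E : Type} (G : GaussDiagram E) (e₀ : E)

theorem addPoint_next_none : (G.addPoint e₀).next none = some (G.next e₀) := by
  simp [addPoint]

theorem addPoint_next_some_self : (G.addPoint e₀).next (some e₀) = none := by
  simp [addPoint]

theorem addPoint_next_some {e : E} (h : e ≠ e₀) :
    (G.addPoint e₀).next (some e) = some (G.next e) := by
  have h' : G.next e ≠ G.next e₀ := fun h' => h (G.next.injective h')
  simp [addPoint, Equiv.swap_apply_of_ne_of_ne, h']

theorem isSubdivision_addPoint : G.IsSubdivision (G.addPoint e₀) := by
  refine ⟨some, none, Option.some_injective _, ?_, ?_, ?_, rfl⟩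
  · ext x
    cases x <;> simp
  · simp [addPoint_next_none]
  · intro e
    by_cases h : e = e₀
    · subst h
      exact Or.inr ⟨G.addPoint_next_some_self e, G.addPoint_next_none e⟩
    · exact Or.inl (G.addPoint_next_some e₀ h)

end GaussDiagram

/-- A diagram is virtually isotopic to a diagram that arises from it by adding subdivision points:
it is recovered as the first return map. -/
theorem VirtuallyIsotopic.of_firstReturn (n : ℕ) {E F : Type} (G : GaussDiagram E)
    (G' : GaussDiagram F) (f : E → F) (k : E → ℕ) (hcard : Nat.card F ≤ Nat.card E + n)
    (hf : Function.Injective f) (hc : G'.chords = Chord.map f '' G.chords)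
    (hk : ∀ e, 0 < k e) (hk' : ∀ e, (G'.next ^ k e) (f e) = f (G.next e))
    (hr : ∀ e j, 0 < j → j < k e → (G'.next ^ j) (f e) ∉ Set.range f)
    (hs : ∀ y, ∃ e, ∃ j : ℕ, (G'.next ^ j) (f e) = y) : VirtuallyIsotopic G G' := by
  have := G.finite
  have := G'.finite
  induction n generalizing E with
  | zero =>
    have hbij : Function.Bijective f :=
      (Nat.bijective_iff_injective_and_card f).2
        ⟨hf, le_antisymm (Nat.card_le_card_of_injective f hf) hcard⟩
    refine .relabel ⟨Equiv.ofBijective f hbij, fun e => ?_, hc⟩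
    have : k e = 1 := by
      by_contra hne
      have := hk e
      exact hr e 1 one_pos (by omega) (hbij.2 _)
    have h := hk' e
    rw [this, pow_one] at h
    exact h
  | succ n ih =>
    by_cases hsurj : Function.Surjective f
    · exact ih G f k (by
        rw [← Nat.card_congr (Equiv.ofBijective f ⟨hf, hsurj⟩)]
        omega) hf hc hk hk' hr hs inferInstance
    obtain ⟨e₀, he₀⟩ : ∃ e, G'.next (f e) ∉ Set.range f := by
      by_contra! h
      apply hsurj
      intro y
      obtain ⟨e, j, rfl⟩ := hs y
      change (G'.next ^ j) (f e) ∈ Set.range f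
      induction j with
      | zero => exact ⟨e, rfl⟩
      | succ j ihj =>
        obtain ⟨e', he'⟩ := ihj
        rw [pow_succ', Equiv.Perm.mul_apply, ← he']
        exact h e'
    set d := G'.next (f e₀) with hd
    have hpow : ∀ j, (G'.next ^ j) d = (G'.next ^ (j + 1)) (f e₀) := by
      intro j
      rw [pow_succ, Equiv.Perm.mul_apply]
    have hfd : ∀ e, f e ≠ d := fun e he => he₀ ⟨e, he⟩
    have hk0 : 2 ≤ k e₀ := by
      by_contra hlt
      have h0 := hk e₀
      have h1 : k e₀ = 1 := by omega
      have h2 := hk' e₀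
      rw [h1, pow_one] at h2
      exact he₀ ⟨_, h2.symm⟩
    have hne : ∀ e j, 0 < j → j < k e → (G'.next ^ j) (f e) = d → e = e₀ ∧ j = 1 := by
      intro e j hj hjk hjd
      obtain ⟨i, rfl⟩ : ∃ i, j = i + 1 := ⟨j - 1, by omega⟩
      rw [pow_succ', Equiv.Perm.mul_apply, hd] at hjd
      have h1 := G'.next.injective hjd
      rcases Nat.eq_zero_or_pos i with rfl | hi
      · exact ⟨hf h1, rfl⟩
      · exact absurd ⟨e₀, h1.symm⟩ (hr e i hi (by omega))
    refine (VirtuallyIsotopic.subdivide (G.isSubdivision_addPoint e₀)).trans ?_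
    classical
    have hrange : ∀ y, y ∉ Set.range f → y ≠ d →
        y ∉ Set.range (fun o : Option E => o.elim d f) := by
      rintro y hy hyd ⟨_ | e, rfl⟩
      · exact hyd rfl
      · exact hy ⟨e, rfl⟩
    -- The new point cuts the return path of `e₀` after its first step: `e₀` now returns after 1
    -- step and the new point after the remaining `k e₀ - 1`.
    refine ih (G.addPoint e₀) (fun o => o.elim d f)
      (fun o => o.elim (k e₀ - 1) fun e => if e = e₀ then 1 else k e) ?_ ?_ ?_ ?_ ?_ ?_ ?_
      inferInstance
    · rw [Finite.card_option]
      omega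
    · rintro (_ | e) (_ | e') h
      · rfl
      · exact (hfd _ h.symm).elim
      · exact (hfd _ h).elim
      · exact congrArg some (hf h)
    · rw [hc]
      change _ = Chord.map _ '' (Chord.map some '' G.chords)
      rw [Set.image_image]
      rfl
    · rintro (_ | e)
      · simp only [Option.elim]
        omega
      · simp only [Option.elim]
        split_ifs
        · exact one_pos
        · exact hk e
    · rintro (_ | e)
      · rw [G.addPoint_next_none]
        simp only [Option.elim]
        rw [hpow, Nat.sub_add_cancel (by omega), hk']
      · by_cases he : e = e₀
        · subst he
          rw [G.addPoint_next_some_self]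
          simp only [Option.elim, if_true, pow_one]
          rfl
        · rw [G.addPoint_next_some e₀ he]
          simp only [Option.elim, he, if_false]
          exact hk' e
    · rintro (_ | e) j hj hjk
      · simp only [Option.elim] at hjk ⊢
        apply hrange
        · rw [hpow]
          exact hr e₀ _ (by omega) (by omega)
        · intro h
          rw [hpow] at h
          have := (hne e₀ (j + 1) (by omega) (by omega) h).2
          omega
      · simp only [Option.elim] at hjk ⊢
        by_cases he : e = e₀
        · rw [if_pos he] at hjk
          omega
        · rw [if_neg he] at hjk
          exact hrange _ (hr e j hj hjk) fun h => he (hne e j hj hjk h).1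
    · intro y
      obtain ⟨e, j, h⟩ := hs y
      exact ⟨some e, j, h⟩

end VirtualKnot
end

/-! ### Braids with prescribed chords and permutation -/

noncomputable section
namespace VirtualKnot

namespace VirtualBraid

variable {n : ℕ}

/-- The positions of the strands at level `l` of a braid, if they start in the positions `π`. -/
def position (π : Equiv.Perm (Fin (n + 1))) : VirtualBraid n → ℕ → Equiv.Perm (Fin (n + 1))
  | _, 0 => π
  | [], _ + 1 => π
  | g :: β, l + 1 => position (g.perm * π) β l

/-- The positions of the strands at the end of a braid. -/
def finalPosition (π : Equiv.Perm (Fin (n + 1))) : VirtualBraid n → Equiv.Perm (Fin (n + 1))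
  | [] => π
  | g :: β => finalPosition (g.perm * π) β

/-- The chord of a generator, on the positions of the strands, as a list. -/
def letterChords : BraidLetter n → List (Chord (Fin (n + 1)))
  | .sigma i ε => [if ε = 1 then ⟨i.succ, i.castSucc, 1⟩ else ⟨i.castSucc, i.succ, -1⟩]
  | .tau _ => []

/-- The chords of a braid, in their order from top to bottom, on the set of strands. -/
def strandChords (π : Equiv.Perm (Fin (n + 1))) :
    VirtualBraid n → List (Chord (Fin (n + 1)))
  | [] => []
  | g :: β => (letterChords g).map (Chord.map π.symm) ++ strandChords (g.perm * π) β

theorem position_zero (π : Equiv.Perm (Fin (n + 1))) (β : VirtualBraid n) :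
    position π β 0 = π := by
  cases β <;> rfl

theorem position_length (π : Equiv.Perm (Fin (n + 1))) (β : VirtualBraid n) :
    position π β β.length = finalPosition π β := by
  induction β generalizing π with
  | nil => rfl
  | cons g β ih => exact ih _

theorem position_succ (π : Equiv.Perm (Fin (n + 1))) (β : VirtualBraid n) (l : ℕ) :
    position π β (l + 1) = permAt β l * position π β l := by
  induction β generalizing π l with
  | nil =>
    have : permAt ([] : VirtualBraid n) l = 1 := by simp [permAt]
    rw [this, one_mul]
    cases l <;> rfl
  | cons g β ih =>
    cases l with
    | zero =>
      change position (g.perm * π) β 0 = _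
      rw [position_zero, position_zero]
      rfl
    | succ l => exact ih _ l

theorem mem_letterChords {g : BraidLetter n} {c : Chord (Fin (n + 1))} :
    c ∈ letterChords g ↔ c ∈ g.chords := by
  cases g <;> simp [letterChords, BraidLetter.chords]

theorem levelChords_nil (l : ℕ) : levelChords ([] : VirtualBraid n) l = ∅ := by
  simp [levelChords]

theorem map_symm_map {E F : Type} (e : E ≃ F) (c : Chord E) : (c.map e).map e.symm = c := by
  simp [Chord.map]

theorem map_map_symm {E F : Type} (e : E ≃ F) (c : Chord F) : (c.map e.symm).map e = c := by
  simp [Chord.map]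

theorem mem_strandChords_of_level {π : Equiv.Perm (Fin (n + 1))} {β : VirtualBraid n} {l : ℕ}
    {c : Chord (Fin (n + 1))} (h : c.map (position π β l) ∈ levelChords β l) :
    c ∈ strandChords π β := by
  induction β generalizing π l with
  | nil => simp [levelChords_nil] at h
  | cons g β ih =>
    rw [strandChords, List.mem_append]
    cases l with
    | zero =>
      refine Or.inl (List.mem_map.2 ⟨_, mem_letterChords.2 h, ?_⟩)
      rw [position_zero, map_symm_map]
    | succ l => exact Or.inr (ih h)

theorem exists_level_of_mem_strandChords {π : Equiv.Perm (Fin (n + 1))} {β : VirtualBraid n}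
    {c : Chord (Fin (n + 1))} (h : c ∈ strandChords π β) :
    ∃ l < β.length, c.map (position π β l) ∈ levelChords β l := by
  induction β generalizing π with
  | nil => simp [strandChords] at h
  | cons g β ih =>
    rw [strandChords, List.mem_append] at h
    rcases h with h | h
    · obtain ⟨d, hd, rfl⟩ := List.mem_map.1 h
      refine ⟨0, by simp, ?_⟩
      rw [position_zero, map_map_symm]
      exact mem_letterChords.1 hd
    · obtain ⟨l, hl, h'⟩ := ih h
      exact ⟨l + 1, by simpa using hl, h'⟩

/-- A chord read off at two levels would occur twice in the list; this makes the level of a chord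
well defined. -/
theorem level_unique {π : Equiv.Perm (Fin (n + 1))} {β : VirtualBraid n}
    (hnd : (strandChords π β).Nodup) {c : Chord (Fin (n + 1))} {l l' : ℕ}
    (h : c.map (position π β l) ∈ levelChords β l)
    (h' : c.map (position π β l') ∈ levelChords β l') : l = l' := by
  induction β generalizing π l l' with
  | nil => simp [levelChords_nil] at h
  | cons g β ih =>
    rw [strandChords, List.nodup_append] at hnd
    have key : ∀ m, c.map (position π (g :: β) 0) ∈ levelChords (g :: β) 0 →
        c.map (position π (g :: β) (m + 1)) ∈ levelChords (g :: β) (m + 1) → False := by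
      intro m h0 h1
      have h2 : c ∈ strandChords (g.perm * π) β := mem_strandChords_of_level h1
      rw [position_zero] at h0
      exact hnd.2.2 c (List.mem_map.2 ⟨_, mem_letterChords.2 h0, map_symm_map π c⟩) c h2 rfl
    cases l with
    | zero =>
      cases l' with
      | zero => rfl
      | succ l' => exact (key l' h h').elim
    | succ l =>
      cases l' with
      | zero => exact (key l h' h).elim
      | succ l' => exact congrArg _ (ih hnd.2.1 h h')

/-- Every permutation is the permutation of a word in the virtual generators. -/
theorem exists_virtual_word (ρ : Equiv.Perm (Fin (n + 1))) :
    ∃ w : VirtualBraid n, ∀ (π : Equiv.Perm (Fin (n + 1))) (β : VirtualBraid n),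
      strandChords π (w ++ β) = strandChords (ρ * π) β ∧
      finalPosition π (w ++ β) = finalPosition (ρ * π) β := by
  have hρ : ρ ∈ Submonoid.closure
      (Set.range fun i : Fin n => Equiv.swap i.castSucc i.succ) := by
    rw [Equiv.Perm.mclosure_swap_castSucc_succ]
    trivial
  induction hρ using Submonoid.closure_induction with
  | mem x hx =>
    obtain ⟨i, rfl⟩ := hx
    exact ⟨[.tau i], fun π β => ⟨rfl, rfl⟩⟩
  | one => exact ⟨[], fun π β => ⟨by simp, by simp⟩⟩
  | mul x y _ _ hx hy =>
    obtain ⟨v, hv⟩ := hx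
    obtain ⟨w, hw⟩ := hy
    refine ⟨w ++ v, fun π β => ?_⟩
    rw [List.append_assoc, (hw _ _).1, (hw _ _).2, (hv _ _).1, (hv _ _).2, mul_assoc]
    exact ⟨rfl, rfl⟩

theorem exists_perm_apply_eq {α : Type*} [DecidableEq α] {x y a b : α} (hxy : x ≠ y)
    (hab : a ≠ b) : ∃ σ : Equiv.Perm α, σ x = a ∧ σ y = b := by
  have h : Equiv.swap x a y ≠ a := by
    intro h
    rw [Equiv.swap_apply_eq_iff, Equiv.swap_apply_right] at h
    exact hxy h.symm
  refine ⟨Equiv.swap (Equiv.swap x a y) b * Equiv.swap x a, ?_, ?_⟩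
  · rw [Equiv.Perm.mul_apply, Equiv.swap_apply_left, Equiv.swap_apply_of_ne_of_ne h.symm hab]
  · rw [Equiv.Perm.mul_apply, Equiv.swap_apply_left]

/-- Every list of chords and every permutation of the strands are realized by a virtual braid. -/
theorem exists_braid_strandChords (cs : List (Chord (Fin (n + 1))))
    (hcs : ∀ c ∈ cs, c.overEnd ≠ c.underEnd) (π ρ : Equiv.Perm (Fin (n + 1))) :
    ∃ β : VirtualBraid n, strandChords π β = cs ∧ finalPosition π β = ρ := by
  induction cs generalizing π with
  | nil =>
    obtain ⟨w, hw⟩ := exists_virtual_word (ρ * π⁻¹)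
    refine ⟨w ++ [], ?_⟩
    rw [(hw _ _).1, (hw _ _).2]
    exact ⟨rfl, by simp [finalPosition]⟩
  | cons c cs ih =>
    have hc : c.overEnd ≠ c.underEnd := hcs c (by simp)
    obtain ⟨m, rfl⟩ : ∃ m, n = m + 1 := by
      rcases n with _ | m
      · exact (hc (Subsingleton.elim (α := Fin 1) _ _)).elim
      · exact ⟨m, rfl⟩
    have h01 : (0 : Fin (m + 1)).castSucc ≠ (0 : Fin (m + 1)).succ := Fin.castSucc_lt_succ.ne
    have hneg : ¬ ((-1 : ℤˣ) = 1) := by decide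
    -- Every classical crossing is placed in the first two positions: virtual crossings bring the
    -- two strands there, in the order required by the sign.
    obtain ⟨σ, hσ⟩ : ∃ σ : Equiv.Perm (Fin (m + 1 + 1)),
        letterChords (.sigma 0 c.sign) = [c.map (σ * π : Equiv.Perm (Fin (m + 1 + 1)))] := by
      rcases Int.units_eq_one_or c.sign with h | h
      · obtain ⟨σ, h1, h2⟩ := exists_perm_apply_eq
          (fun h' => hc (π.injective h') : π c.overEnd ≠ π c.underEnd) h01.symm
        exact ⟨σ, by simp [letterChords, h, Chord.map, h1, h2]⟩
      · obtain ⟨σ, h1, h2⟩ := exists_perm_apply_eq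
          (fun h' => hc (π.injective h') : π c.overEnd ≠ π c.underEnd) h01
        exact ⟨σ, by simp [letterChords, h, Chord.map, h1, h2, hneg]⟩
    obtain ⟨w, hw⟩ := exists_virtual_word σ
    obtain ⟨β, hβ, hβ'⟩ := ih (fun d hd => hcs d (by simp [hd]))
      ((BraidLetter.sigma 0 c.sign).perm * (σ * π))
    refine ⟨w ++ (.sigma 0 c.sign :: β), ?_⟩
    rw [(hw _ _).1, (hw _ _).2, strandChords, finalPosition, hβ, hβ', hσ]
    simp only [List.map_cons, List.map_nil, map_symm_map, List.cons_append, List.nil_append,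
      and_self]

end VirtualBraid

end VirtualKnot
end

/-! ### Every diagram is a braid closure -/

noncomputable section
namespace VirtualKnot

namespace VirtualBraid

variable {n : ℕ}

/-- The point at level `l` of the strand that starts in position `x`. -/
def strandPoint (β : VirtualBraid n) (l : ℕ) (x : Fin (n + 1)) :
    Fin (β.length + 1) × Fin (n + 1) :=
  (Fin.ofNat (β.length + 1) l, position 1 β l x)

theorem strandPoint_injective {β : VirtualBraid n} {l l' : ℕ} (hl : l ≤ β.length)
    (hl' : l' ≤ β.length) {x x' : Fin (n + 1)} (h : β.strandPoint l x = β.strandPoint l' x') :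
    l = l' ∧ x = x' := by
  have h1 := congrArg (fun a => (a.1 : ℕ)) h
  simp only [strandPoint, Fin.val_ofNat, Nat.mod_eq_of_lt (Nat.lt_succ_of_le hl),
    Nat.mod_eq_of_lt (Nat.lt_succ_of_le hl')] at h1
  subst h1
  exact ⟨rfl, (position 1 β l).injective (congrArg Prod.snd h)⟩

theorem closure_next_strandPoint {β : VirtualBraid n} {l : ℕ} (hl : l < β.length)
    (x : Fin (n + 1)) : β.closure.next (β.strandPoint l x) = β.strandPoint (l + 1) x := by
  have h1 : Fin.ofNat (β.length + 1) l = ⟨l, by omega⟩ := Fin.ext (Nat.mod_eq_of_lt (by omega))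
  have h2 : Fin.ofNat (β.length + 1) (l + 1) = ⟨l + 1, by omega⟩ :=
    Fin.ext (Nat.mod_eq_of_lt (by omega))
  change (finRotate (β.length + 1) (Fin.ofNat (β.length + 1) l),
    β.permAt (Fin.ofNat (β.length + 1) l : Fin (β.length + 1)) (position 1 β l x)) = _
  rw [strandPoint, position_succ, h1, h2, finRotate_of_lt hl]
  rfl

theorem closure_next_strandPoint_length (β : VirtualBraid n) (x : Fin (n + 1)) :
    β.closure.next (β.strandPoint β.length x) = β.strandPoint 0 (finalPosition 1 β x) := by
  have h1 : Fin.ofNat (β.length + 1) β.length = Fin.last β.length :=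
    Fin.ext (Nat.mod_eq_of_lt (by omega))
  change (finRotate (β.length + 1) (Fin.ofNat (β.length + 1) β.length),
    β.permAt (Fin.ofNat (β.length + 1) β.length : Fin (β.length + 1))
      (position 1 β β.length x)) = _
  have h2 : β.permAt (Fin.last β.length : Fin (β.length + 1)) = 1 := by simp [permAt]
  rw [strandPoint, position_zero, position_length, h1, h2, finRotate_last]
  rfl

theorem closure_next_pow_strandPoint {β : VirtualBraid n} (l j : ℕ) (hl : l + j ≤ β.length)
    (x : Fin (n + 1)) :
    (β.closure.next ^ j) (β.strandPoint l x) = β.strandPoint (l + j) x := by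
  induction j with
  | zero => rfl
  | succ j ih =>
    rw [pow_succ', Equiv.Perm.mul_apply, ih (by omega), closure_next_strandPoint (by omega)]
    rfl

/-- From level l it takes `β.length - l` steps to the bottom level, one step along the closing arc,
and i steps down the next strand. -/
theorem closure_next_pow_strandPoint_wrap {β : VirtualBraid n} (l i : ℕ) (hl : l ≤ β.length)
    (hi : i ≤ β.length) (x : Fin (n + 1)) :
    (β.closure.next ^ (β.length - l + 1 + i)) (β.strandPoint l x) =
      β.strandPoint i (finalPosition 1 β x) := by
  rw [add_comm (β.length - l + 1) i, pow_add, Equiv.Perm.mul_apply, pow_succ', Equiv.Perm.mul_apply,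
    closure_next_pow_strandPoint l _ (by omega), Nat.add_sub_cancel' hl,
    closure_next_strandPoint_length, closure_next_pow_strandPoint 0 i (by omega), zero_add]

/-- A braid whose strands and chords are the points and chords of a diagram has a closure that is
virtually isotopic to the diagram. -/
theorem virtuallyIsotopic_closure {E : Type} (G : GaussDiagram E) (φ : E ≃ Fin (n + 1))
    (β : VirtualBraid n) (hnd : (strandChords 1 β).Nodup)
    (hβ : ∀ c, c ∈ strandChords 1 β ↔ ∃ d ∈ G.chords, c = d.map φ)
    (hfin : ∀ e, finalPosition 1 β (φ e) = φ (G.next e)) : VirtuallyIsotopic G β.closure := by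
  classical
  -- The strand of `e` meets its chord at level `l`. There is at most one such level, as `e` is an
  -- end of at most one chord.
  let P : E → ℕ → Prop := fun e l => ∃ c ∈ G.chords, (c.overEnd = e ∨ c.underEnd = e) ∧
    (c.map φ).map (position 1 β l) ∈ β.levelChords l
  have hP : ∀ e l l', P e l → P e l' → l = l' := by
    rintro e l l' ⟨c, hc, hce, h⟩ ⟨c', hc', hce', h'⟩
    have : c = c' := by
      by_contra hne
      have := G.ends_ne hc hc' hne
      rcases hce with rfl | rfl <;> rcases hce' with h | h
      · exact this.1.1 h.symm
      · exact this.1.2 h.symm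
      · exact this.2.1 h.symm
      · exact this.2.2 h.symm
    subst this
    exact level_unique hnd h h'
  have hPL : ∀ e l, P e l → l ≤ β.length := by
    rintro e l ⟨c, hc, hce, h⟩
    by_contra hl
    have : β.levelChords l = ∅ := by
      simp [levelChords, List.getElem?_eq_none (by omega : β.length ≤ l)]
    rw [this] at h
    exact h
  -- A plain subdivision point may lie at any level of its strand; the default 0 is the top.
  let lev : E → ℕ := fun e => if h : ∃ l, P e l then h.choose else 0
  have hlev : ∀ e l, P e l → lev e = l := by
    intro e l h
    have h' : ∃ l, P e l := ⟨l, h⟩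
    simp only [lev, dif_pos h']
    exact hP e _ _ h'.choose_spec h
  have hlevL : ∀ e, lev e ≤ β.length := by
    intro e
    by_cases h : ∃ l, P e l
    · obtain ⟨l, h⟩ := h
      rw [hlev e l h]
      exact hPL e l h
    · simp [lev, h]
  let f : E → Fin (β.length + 1) × Fin (n + 1) := fun e => β.strandPoint (lev e) (φ e)
  have hf : Function.Injective f := fun e e' h =>
    φ.injective (strandPoint_injective (hlevL e) (hlevL e') h).2
  have hrange : ∀ l e, l ≤ β.length → l ≠ lev e → β.strandPoint l (φ e) ∉ Set.range f := by
    rintro l e hl hne ⟨e', h⟩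
    obtain ⟨h1, h2⟩ := strandPoint_injective (hlevL e') hl h
    obtain rfl := φ.injective h2
    exact hne h1.symm
  have hmap : ∀ c ∈ G.chords, ∀ l, (c.map φ).map (position 1 β l) ∈ β.levelChords l →
      c.map f = ((c.map φ).map (position 1 β l)).map
        (Prod.mk (Fin.ofNat (β.length + 1) l)) := by
    intro c hc l h
    have h1 := hlev c.overEnd l ⟨c, hc, Or.inl rfl, h⟩
    have h2 := hlev c.underEnd l ⟨c, hc, Or.inr rfl, h⟩
    simp [Chord.map, f, strandPoint, h1, h2]
  refine VirtuallyIsotopic.of_firstReturn (Nat.card (Fin (β.length + 1) × Fin (n + 1))) G β.closure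
    f (fun e => β.length - lev e + 1 + lev (G.next e)) (Nat.le_add_left _ _) hf ?_ ?_ ?_ ?_ ?_
  · ext c
    rw [mem_closure_chords]
    constructor
    · rintro ⟨l, d, hd, rfl⟩
      have h1 : (d.map (position 1 β l).symm).map (position 1 β l) ∈ β.levelChords l := by
        rwa [map_map_symm]
      obtain ⟨c, hc, hcd⟩ := (hβ _).1 (mem_strandChords_of_level h1)
      rw [hcd] at h1
      refine ⟨c, hc, ?_⟩
      rw [hmap c hc l h1, ← hcd, map_map_symm, Fin.ofNat_eq_cast, Fin.cast_val_eq_self]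
    · rintro ⟨c, hc, rfl⟩
      obtain ⟨l, hl, h⟩ := exists_level_of_mem_strandChords ((hβ _).2 ⟨c, hc, rfl⟩)
      refine ⟨Fin.ofNat (β.length + 1) l, _, ?_, hmap c hc l h⟩
      rwa [Fin.val_ofNat, Nat.mod_eq_of_lt (by omega)]
  · intro e
    omega
  · intro e
    rw [closure_next_pow_strandPoint_wrap _ _ (hlevL e) (hlevL _), hfin]
  · intro e j hj hjk
    by_cases h : j ≤ β.length - lev e
    · have := hlevL e
      rw [closure_next_pow_strandPoint _ _ (by omega)]
      exact hrange _ e (by omega) (by omega)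
    · obtain ⟨i, rfl⟩ : ∃ i, j = β.length - lev e + 1 + i := ⟨j - (β.length - lev e + 1), by omega⟩
      have := hlevL (G.next e)
      rw [closure_next_pow_strandPoint_wrap _ _ (hlevL e) (by omega), hfin]
      exact hrange _ _ (by omega) (by omega)
  · rintro ⟨l, y⟩
    -- A point may lie above the marked point of its strand, so it is reached from the strand of the
    -- preceding point.
    refine ⟨G.next.symm (φ.symm ((position 1 β l).symm y)), _,
      (closure_next_pow_strandPoint_wrap _ l (hlevL _) (by omega) _).trans ?_⟩
    rw [hfin, Equiv.apply_symm_apply, Equiv.apply_symm_apply, strandPoint,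
      Equiv.apply_symm_apply, Fin.ofNat_eq_cast, Fin.cast_val_eq_self]

end VirtualBraid

/-- Alexander's theorem for virtual links. -/
theorem exists_closure_virtuallyIsotopic {E : Type} [Nonempty E] (G : GaussDiagram E) :
    ∃ (n : ℕ) (β : VirtualBraid n), VirtuallyIsotopic β.closure G := by
  have := G.finite
  obtain ⟨n, hn⟩ : ∃ n, Nat.card E = n + 1 :=
    Nat.exists_eq_succ_of_ne_zero (Nat.card_ne_zero.2 ⟨inferInstance, inferInstance⟩)
  let φ : E ≃ Fin (n + 1) := Finite.equivFinOfCardEq hn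
  obtain ⟨β, hβ, hβ'⟩ := VirtualBraid.exists_braid_strandChords
    (G.chords.toFinite.toFinset.toList.map (Chord.map φ))
    (by
      intro c hc
      obtain ⟨d, hd, rfl⟩ := List.mem_map.1 hc
      have hd' : d ∈ G.chords := by simpa using hd
      exact fun h => G.over_ne_under d hd' d hd' (φ.injective h))
    -- The strands are the points of the diagram and the closing arcs join each point to its
    -- successor, so the order of the chords in the list is immaterial.
    1 (φ.permCongr G.next)
  refine ⟨n, β, (VirtualBraid.virtuallyIsotopic_closure G φ β ?_ ?_ ?_).symm⟩
  · rw [hβ]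
    exact (Finset.nodup_toList _).map (Chord.map_injective φ.injective)
  · intro c
    rw [hβ, List.mem_map]
    simp only [Finset.mem_toList, Set.Finite.mem_toFinset, eq_comm]
  · intro e
    rw [hβ']
    simp

/-! ### The polynomial of a diagram and the congruence -/

theorem exists_isNormalizedVirtualAlexander {E : Type} [Nonempty E] (G : GaussDiagram E) :
    ∃ h, IsNormalizedVirtualAlexander G h := by
  obtain ⟨n, β, hβ⟩ := exists_closure_virtuallyIsotopic G
  exact ⟨_, n, β, 0, hβ, rfl⟩

/-- The normalized virtual Alexander polynomial is the Alexander determinant, up to powers of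
`s * t`. -/
theorem IsNormalizedVirtualAlexander.eq_mul_alexanderInvariant {E : Type} {G : GaussDiagram E}
    {h : Laurent} (hG : IsNormalizedVirtualAlexander G h) :
    ∃ m : ℤ, h = mono m m 0 * G.alexanderInvariant overWeight underWeight := by
  obtain ⟨n, β, m, hβ, rfl⟩ := hG
  obtain ⟨k, hk⟩ := hβ.symm.alexanderInvariant_eq overWeight underWeight
  rw [GaussDiagram.alexanderInvariant_eq, VirtualBraid.alexanderDet_closure,
    val_overWeight_mul_underWeight_zpow] at hk
  exact ⟨m + k, by rw [hk, ← mul_assoc, mono_mul_mono, add_zero]⟩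

theorem mono_pow (a b c : ℤ) (N : ℕ) : mono a b c ^ N = mono (N * a) (N * b) (N * c) := by
  induction N with
  | zero => simp [mono_zero]
  | succ N ih =>
    rw [pow_succ, ih, mono_mul_mono]
    congr 1 <;> push_cast <;> ring

/-- The Alexander determinant of a diagram of period `p ^ r` is congruent modulo `p` to a power of
that of its quotient. -/
theorem GaussDiagram.IsPeriodic.dvd_alexanderInvariant_sub_pow {E : Type} {p r : ℕ} (hp : p.Prime)
    {G : GaussDiagram E} (hG : G.IsPeriodic (p ^ r)) :
    (p : Laurent) ∣ G.alexanderInvariant overWeight underWeight -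
      (G.quotient (p ^ r) hG).alexanderInvariant overWeight underWeight ^ p ^ r := by
  classical
  have := Fact.mk hp
  have := G.finite
  have := Fintype.ofFinite E
  have := Fintype.ofFinite (G.QuotientPoint (p ^ r))
  apply dvd_of_reduction_eq_zero
  rw [GaussDiagram.alexanderInvariant_eq, GaussDiagram.alexanderInvariant_eq, map_sub, map_pow,
    GaussDiagram.alexanderDet_map, GaussDiagram.alexanderDet_map, hG.alexanderDet_eq_pow, sub_self]

end VirtualKnot

end

theorem mainTheorem7 {E : Type} (p : ℕ) (hp : p.Prime) (r : ℕ) (K : VirtualKnot.GaussDiagram E)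
    (hK : K.IsPeriodic (p ^ r)) :
    (∃ h, VirtualKnot.IsNormalizedVirtualAlexander K h) ∧
    (∃ h, VirtualKnot.IsNormalizedVirtualAlexander (K.quotient (p ^ r) hK) h) ∧
    ∀ h h' : VirtualKnot.Laurent, VirtualKnot.IsNormalizedVirtualAlexander K h →
      VirtualKnot.IsNormalizedVirtualAlexander (K.quotient (p ^ r) hK) h' →
      ∃ m : ℤ, (p : VirtualKnot.Laurent) ∣ h - VirtualKnot.mono m m 0 * h' ^ (p ^ r) := by
  have := hK.isKnot.1
  have : Nonempty (K.QuotientPoint (p ^ r)) := ⟨K.toQuotient (p ^ r) (Classical.arbitrary E)⟩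
  refine ⟨VirtualKnot.exists_isNormalizedVirtualAlexander K,
    VirtualKnot.exists_isNormalizedVirtualAlexander _, fun h h' hh hh' => ?_⟩
  obtain ⟨a, ha⟩ := hh.eq_mul_alexanderInvariant
  obtain ⟨b, hb⟩ := hh'.eq_mul_alexanderInvariant
  -- The p^r-th power multiplies the exponent b by p^r, so this m leaves the common factor (st)^a.
  refine ⟨a - (p ^ r : ℕ) * b, ?_⟩
  have h1 := (hK.dvd_alexanderInvariant_sub_pow hp).mul_left (VirtualKnot.mono a a 0)
  rw [ha, hb, mul_pow, VirtualKnot.mono_pow, ← mul_assoc, VirtualKnot.mono_mul_mono,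
    sub_add_cancel, mul_zero, add_zero, ← mul_sub]
  exact h1
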